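/- Let $G$ be a real Lie group of dimension $n$ with Lie algebra $\mathfrak g$. Let $T^*G$ carry its canonical Poisson bracket. Let $J_R,J_L:T^*G\to\mathfrak g^*$ be the maps $J_R(g,p)=p\circ d(L_g)_1$ and $J_L(g,p)=p\circ d(R_g)_1$, the momentum maps of the lifted right and left translations. Suppose that the generic coadjoint orbit is $2$-dimensional, i.e. the set of $\mu\in\mathfrak g^*$ whose coadjoint orbit has dimension $2$ is dense in $\mathfrak g^*$. Let $H:T^*G\to\mathbb R$ be smooth and left-invariant. Call $H$ *nowhere Casimir* if there is no nonempty open subset of $T^*G$ on which $H$ Poisson commutes with all components of $J_R$. A *Casimir* on an open set $U\subseteq\mathfrak g^*$ is a smooth function on $U$ whose Lie–Poisson bracket with every smooth function vanishes. Then: 1. The Hamiltonian flow of $H$ is integrable: there are smooth functions $F_1,\dots,F_n$ on $T^*G$ with $\{F_i,H\}=0$ and $\{F_i,F_j\}=0$ for all $i,j$, whose differentials are linearly independent on a dense subset of $T^*G$. If $H$ is nowhere Casimir, then $H$ can be taken to be one of the $F_i$. 2. Every $\mu\in\mathfrak g^*$ whose coadjoint orbit is $2$-dimensional has an open neighbourhood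 $U$ with $n-2$ Casimirs $C_1,\dots,C_{n-2}$ on $U$ whose differentials are linearly independent at every point of $U$. 3. Let $U\subseteq\mathfrak g^*$ be any open set (for instance $U=\mathfrak g^*$), let $C_1,\dots,C_{n-2}$ be Casimirs on $U$ whose differentials are linearly independent on a dense subset of $U$, and let $\xi\in\mathfrak g$ be a non-central element. Then the $n$ functions $C_1\circ J_R,\dots,C_{n-2}\circ J_R,\ H,\ \langle J_L,\xi\rangle$ are pairwise in involution on $J_R^{-1}(U)$. If $H$ is nowhere Casimir, their differentials are linearly independent on a dense subset of $J_R^{-1}(U)$. -/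

import Mathlib

open scoped Manifold ContDiff
open Bundle

noncomputable section

/-- The cotangent bundle `T*G` of a manifold `G` modelled on `E`, with Mathlib's manifold structure
of a bundle of continuous linear maps. Its preferred chart at a covector over `g₀` is the canonical
chart `(g, p) ↦ (q, p ∘ (dφ_g)⁻¹)`, `q = φ(g)`, induced by the preferred chart `φ` of `G`
at `g₀`. -/
abbrev CotangentBundle (E : Type*) [NormedAddCommGroup E] [NormedSpace ℝ E]
    (G : Type*) [TopologicalSpace G] [ChartedSpace E G] : Type _ :=
  TotalSpace (E →L[ℝ] ℝ) (fun g : G => TangentSpace 𝓘(ℝ, E) g →L[ℝ] Trivial G ℝ g)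

/-- The model with corners of `T*G`: its model space is `E × E*`. -/
abbrev cotangentModel (E : Type*) [NormedAddCommGroup E] [NormedSpace ℝ E] :
    ModelWithCorners ℝ (E × (E →L[ℝ] ℝ)) (ModelProd E (E →L[ℝ] ℝ)) :=
  (𝓘(ℝ, E)).prod 𝓘(ℝ, E →L[ℝ] ℝ)

section Bidual

variable {E : Type*} [NormedAddCommGroup E] [NormedSpace ℝ E] [FiniteDimensional ℝ E]

/-- The vector of `E` that represents a linear functional on `E*` (see `apply_bidualVector`). -/
def bidualVector (φ : (E →L[ℝ] ℝ) →L[ℝ] ℝ) : E :=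
  ∑ i, φ (LinearMap.toContinuousLinearMap ((Module.finBasis ℝ E).coord i)) • Module.finBasis ℝ E i

theorem apply_bidualVector (φ : (E →L[ℝ] ℝ) →L[ℝ] ℝ) (μ : E →L[ℝ] ℝ) :
    μ (bidualVector φ) = φ μ := by
  have h : μ = ∑ i, μ (Module.finBasis ℝ E i) •
      LinearMap.toContinuousLinearMap ((Module.finBasis ℝ E).coord i) := by
    ext v
    conv_lhs => rw [← (Module.finBasis ℝ E).sum_repr v, map_sum]
    simp [-Module.Basis.sum_repr, mul_comm]
  conv_rhs => rw [h]
  simp [bidualVector, mul_comm]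

end Bidual

section Cotangent

variable {E : Type*} [NormedAddCommGroup E] [NormedSpace ℝ E]
  {G : Type*} [TopologicalSpace G] [ChartedSpace E G] [IsManifold 𝓘(ℝ, E) ∞ G]

/-- Smooth functions on `T*G`. -/
def IsSmoothOnCotangent (F : CotangentBundle E G → ℝ) : Prop :=
  ContMDiff (cotangentModel E) 𝓘(ℝ, ℝ) ∞ F

/-- The differential of `F` at `x ∈ T*G`, read in the canonical coordinates `(q, p) ∈ E × E*`
of the preferred chart at `x` (this is how Mathlib represents tangent vectors at `x`). -/
def cotangentDiff (F : CotangentBundle E G → ℝ) (x : CotangentBundle E G) :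
    (E × (E →L[ℝ] ℝ)) →L[ℝ] ℝ :=
  mfderiv (cotangentModel E) 𝓘(ℝ, ℝ) F x

variable [FiniteDimensional ℝ E]

/-- The vector `∂F/∂p ∈ E`. -/
def momentumGradient (F : CotangentBundle E G → ℝ) (x : CotangentBundle E G) : E :=
  bidualVector ((cotangentDiff F x).comp (ContinuousLinearMap.inr ℝ E (E →L[ℝ] ℝ)))

/-- The canonical Poisson bracket of `T*G`:
`{F, K} = ∑ᵢ (∂F/∂qᵢ ∂K/∂pᵢ - ∂K/∂qᵢ ∂F/∂pᵢ)` in canonical coordinates. -/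
def poissonBracket (F K : CotangentBundle E G → ℝ) (x : CotangentBundle E G) : ℝ :=
  cotangentDiff F x (momentumGradient K x, 0) - cotangentDiff K x (momentumGradient F x, 0)

/-- The functions `F₁, …, F_n` (`n = dim G`) are a complete system of integrals for the Hamiltonian
flow of `H` on `T*G`: smooth integrals of that flow, in involution, with differentials that are
linearly independent on a dense (automatically open) subset. -/
structure IsCompleteSystemOfIntegrals (H : CotangentBundle E G → ℝ)
    (F : Fin (Module.finrank ℝ E) → CotangentBundle E G → ℝ) : Prop where
  smooth : ∀ i, IsSmoothOnCotangent (F i)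
  integral : ∀ i x, poissonBracket (F i) H x = 0
  involution : ∀ i j x, poissonBracket (F i) (F j) x = 0
  independent : Dense {x | LinearIndependent ℝ (fun i => cotangentDiff (F i) x)}

end Cotangent

section Group

variable {E : Type*} [NormedAddCommGroup E] [NormedSpace ℝ E]
  {G : Type*} [TopologicalSpace G] [ChartedSpace E G] [Group G]

/-- `H` is invariant under the action of `G` on `T*G` lifted from left translation: pulling a
covector at `a * g` back by `L_a` does not change the value of `H`. -/
def IsLeftInvariant (H : CotangentBundle E G → ℝ) : Prop :=
  ∀ (a g : G) (p : TangentSpace 𝓘(ℝ, E) (a * g) →L[ℝ] ℝ),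
    H ⟨g, p.comp (mfderiv 𝓘(ℝ, E) 𝓘(ℝ, E) (fun x : G => a * x) g)⟩ = H ⟨a * g, p⟩

/-- `J_R (g, p) = p ∘ d(L_g)₁`: left translation of a covector back to the identity. The Lie
algebra `T₁G` is `E` as a vector space, so its dual `𝔤*` is `E →L[ℝ] ℝ`. -/
def rightMomentum (x : CotangentBundle E G) : E →L[ℝ] ℝ :=
  ContinuousLinearMap.comp (M₁ := E) (M₂ := TangentSpace 𝓘(ℝ, E) x.proj) (M₃ := ℝ)
    x.snd (mfderiv 𝓘(ℝ, E) 𝓘(ℝ, E) (fun y : G => x.proj * y) 1)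

/-- `J_L (g, p) = p ∘ d(R_g)₁`: right translation of a covector back to the identity, the momentum
map of the lifted action by left translation. -/
def leftMomentum (x : CotangentBundle E G) : E →L[ℝ] ℝ :=
  ContinuousLinearMap.comp (M₁ := E) (M₂ := TangentSpace 𝓘(ℝ, E) x.proj) (M₃ := ℝ)
    x.snd (mfderiv 𝓘(ℝ, E) 𝓘(ℝ, E) (fun y : G => y * x.proj) 1)

variable (G) in
/-- The Lie bracket of `𝔤 = T₁G = E`. -/
def algBracket (ξ η : E) : E :=
  Bracket.bracket (L := GroupLieAlgebra 𝓘(ℝ, E) G) (M := GroupLieAlgebra 𝓘(ℝ, E) G) ξ η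

/-- The adjoint action `Ad_g`, the differential at the identity of `x ↦ g x g⁻¹`. -/
def adjointMap (g : G) : E →L[ℝ] E :=
  mfderiv 𝓘(ℝ, E) 𝓘(ℝ, E) (fun x : G => g * x * g⁻¹) 1

/-- The coadjoint action `μ ↦ μ ∘ Ad_{g⁻¹}` on `𝔤*`. -/
def coadjointMap (g : G) (μ : E →L[ℝ] ℝ) : E →L[ℝ] ℝ :=
  μ.comp (adjointMap g⁻¹)

variable (G) in
/-- The dimension of the coadjoint orbit `G · μ`, which is the immersed submanifold `G / G_μ`
of `𝔤*`: the rank of the orbit map `g ↦ Ad*_g μ` (a map of constant rank) at the identity. -/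
def coadjointOrbitDim (μ : E →L[ℝ] ℝ) : ℕ :=
  Module.finrank ℝ (LinearMap.range
    (mfderiv 𝓘(ℝ, E) 𝓘(ℝ, E →L[ℝ] ℝ) (fun g : G => coadjointMap g μ) 1).toLinearMap)

variable [FiniteDimensional ℝ E]

variable (G) in
/-- The Lie-Poisson bracket on `𝔤*`: `{f, k}(μ) = μ([df_μ, dk_μ])`, with `df_μ, dk_μ ∈ 𝔤** = 𝔤`. -/
def liePoissonBracket (f k : (E →L[ℝ] ℝ) → ℝ) (μ : E →L[ℝ] ℝ) : ℝ :=
  μ (algBracket G (bidualVector (fderiv ℝ f μ)) (bidualVector (fderiv ℝ k μ)))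

variable (G) in
/-- `C` is a (smooth) Casimir on the open set `U ⊆ 𝔤*`. -/
structure IsCasimirOn (C : (E →L[ℝ] ℝ) → ℝ) (U : Set (E →L[ℝ] ℝ)) : Prop where
  smooth : ContDiffOn ℝ ∞ C U
  casimir : ∀ k : (E →L[ℝ] ℝ) → ℝ, ContDiff ℝ ∞ k → ∀ μ ∈ U, liePoissonBracket G C k μ = 0

/-- There is no nonempty open subset of `T*G` on which `H` Poisson commutes with every component of
`J_R`, that is, on which the left-invariant function `H` comes from a Casimir of `𝔤*`. -/
def IsNowhereCasimir [IsManifold 𝓘(ℝ, E) ∞ G] (H : CotangentBundle E G → ℝ) : Prop :=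
  Dense {x | ∃ η : E, poissonBracket H (fun y => rightMomentum y η) x ≠ 0}

/-- The `n` functions `C₁ ∘ J_R, …, C_{n-2} ∘ J_R, H, ⟨J_L, ξ⟩` on `T*G`. -/
def casimirFamily (C : Fin (Module.finrank ℝ E - 2) → (E →L[ℝ] ℝ) → ℝ)
    (H : CotangentBundle E G → ℝ) (ξ : E) :
    Fin (Module.finrank ℝ E - 2) ⊕ Fin 2 → CotangentBundle E G → ℝ :=
  Sum.elim (fun i x => C i (rightMomentum x)) ![H, fun x => leftMomentum x ξ]

end Group

end

/-! Left invariance makes `H` a composite `h ∘ J_R`, with `h` the restriction of `H` to the fibre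
over the identity (`isLeftInvariant_eq`). Components of `J_R` and `J_L` are the fibrewise linear
functions defined by left- and right-invariant vector fields, so their Poisson brackets are brackets
of vector fields: each map carries the Lie–Poisson bracket to the canonical one up to sign, and
functions of `J_R` commute with functions of `J_L` because left and right translations commute. Both
maps restrict to linear isomorphisms on every fibre, so density and independence of differentials
pull back from `𝔤*`. What remains is a problem about functions on `𝔤*`.

The orbit through `μ` has dimension the rank of the form `μ([·,·])` (`coadjointOrbitDim_eq`). Rank
two on a dense set gives the Plücker relation for every `μ`, since that relation is closed
(`isDecomposable_algBracketCLM`). It has a local and a global consequence.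

Locally, the Hamiltonian vectors at each point near a two-dimensional orbit span a plane. The
coadjoint flows are linear, hence exponentials, and they give a chart in which that plane is
constant; linear functions annihilating it are the Casimirs (`exists_local_invariants`).

Globally, the relation is quadratic in `μ` and can be polarized. It forces an abelian hyperplane, or
a central extension of a three-dimensional algebra with independent brackets
(`exists_abelian_hyperplane_or`). Either way there are `n - 1` smooth functions in involution on all
of `𝔤*` (`hasCommutingFamily`); composed with `J_L` they are integrals of `H`. The last integral is
`H` itself when `H` is nowhere Casimir. Otherwise `h` is altered only where it is locally Casimir,
which keeps it in involution with `h` and makes it nowhere Casimir (`exists_generic_perturbation`).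

In the third claim, independence is detected by brackets: some component of `J_R` fails to commute
with `H` but commutes with the Casimirs and with `⟨J_L, ξ⟩`, and some component of `J_L` fails to
commute only with `⟨J_L, ξ⟩`. -/

noncomputable section

/-! ### Functions on `T*G` that are linear on the fibres, and their Poisson brackets. -/

section FieldMomentum

open VectorField Filter Topology

variable {E : Type*} [NormedAddCommGroup E] [NormedSpace ℝ E]
  {G : Type*} [TopologicalSpace G] [ChartedSpace E G]

/-- The function `(g, p) ↦ p (X g)` on `T*G` defined by a vector field `X` on `G`. -/
def fieldMomentum (X : ∀ g : G, TangentSpace 𝓘(ℝ, E) g) (x : CotangentBundle E G) : ℝ :=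
  x.snd (X x.proj)

/-- The covector `p` of a point `(g, p)` of `T*G`, as a functional on the model space. -/
def covector (x : CotangentBundle E G) : E →L[ℝ] ℝ := x.snd

/-- The expression of a vector field in the preferred chart at `g₀`. -/
def chartField (g₀ : G) (X : ∀ g : G, TangentSpace 𝓘(ℝ, E) g) : E → E :=
  mpullbackWithin 𝓘(ℝ, E) 𝓘(ℝ, E) (extChartAt 𝓘(ℝ, E) g₀).symm X (Set.range 𝓘(ℝ, E))

variable [IsManifold 𝓘(ℝ, E) ∞ G]

theorem chartField_apply {g₀ g : G} (hg : g ∈ (chartAt E g₀).source)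
    (X : ∀ g : G, TangentSpace 𝓘(ℝ, E) g) :
    chartField g₀ X (extChartAt 𝓘(ℝ, E) g₀ g) =
      mfderiv 𝓘(ℝ, E) 𝓘(ℝ, E) (extChartAt 𝓘(ℝ, E) g₀) g (X g) := by
  have hg' : g ∈ (extChartAt 𝓘(ℝ, E) g₀).source := by simpa using hg
  have : IsManifold 𝓘(ℝ, E) 1 G := inferInstance
  have A : (extChartAt 𝓘(ℝ, E) g₀).symm (extChartAt 𝓘(ℝ, E) g₀ g) = g :=
    (extChartAt 𝓘(ℝ, E) g₀).left_inv hg'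
  have h1 := mfderivWithin_extChartAt_symm_comp_mfderiv_extChartAt' (I := 𝓘(ℝ, E)) hg'
  have h2 := mfderiv_extChartAt_comp_mfderivWithin_extChartAt_symm' (I := 𝓘(ℝ, E)) hg'
  refine (DFunLike.congr_fun (ContinuousLinearMap.inverse_eq h1 h2)
    (X ((extChartAt 𝓘(ℝ, E) g₀).symm (extChartAt 𝓘(ℝ, E) g₀ g)))).trans ?_
  exact congrArg (fun g' => (mfderiv 𝓘(ℝ, E) 𝓘(ℝ, E) (extChartAt 𝓘(ℝ, E) g₀) g : E → E) (X g')) A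

theorem chartField_self (g₀ : G) (X : ∀ g : G, TangentSpace 𝓘(ℝ, E) g) :
    chartField g₀ X (extChartAt 𝓘(ℝ, E) g₀ g₀) = X g₀ := by
  have : IsManifold 𝓘(ℝ, E) 1 G := inferInstance
  rw [chartField_apply (mem_chart_source E g₀), mfderiv_extChartAt_self]
  rfl

/-- The canonical chart transforms covectors by the inverse transpose of the chart derivative and
vectors by the derivative itself, so the pairing is unchanged. Near `x` the function is therefore
`(q, p) ↦ p (X q)`, which the product rule differentiates. -/
theorem fieldMomentum_eq_chart (x y : CotangentBundle E G)
    (hy : y.proj ∈ (chartAt E x.proj).source) (X : ∀ g : G, TangentSpace 𝓘(ℝ, E) g) :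
    fieldMomentum X y = (extChartAt (cotangentModel E) x y).2
      (chartField x.proj X (extChartAt (cotangentModel E) x y).1) := by
  have : IsManifold 𝓘(ℝ, E) 1 G := inferInstance
  have h1 : (extChartAt (cotangentModel E) x y).1 = extChartAt 𝓘(ℝ, E) x.proj y.proj := by
    rw [FiberBundle.extChartAt]
    rfl
  have h2 : (extChartAt (cotangentModel E) x y).2 =
      ContinuousLinearMap.inCoordinates E (TangentSpace 𝓘(ℝ, E)) ℝ (Trivial G ℝ)
        x.proj y.proj x.proj y.proj y.snd := by
    rw [FiberBundle.extChartAt]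
    rfl
  have h3 : chartField x.proj X (extChartAt 𝓘(ℝ, E) x.proj y.proj) =
      (trivializationAt E (TangentSpace 𝓘(ℝ, E)) x.proj).continuousLinearMapAt ℝ y.proj
        (X y.proj) := by
    rw [chartField_apply hy]
    exact (DFunLike.congr_fun (TangentBundle.continuousLinearMapAt_trivializationAt
      (I := 𝓘(ℝ, E)) hy) (X y.proj)).symm
  have hb : y.proj ∈ (trivializationAt E (TangentSpace 𝓘(ℝ, E)) x.proj).baseSet := by
    simpa using hy
  rw [h1, h2, h3]
  simp only [ContinuousLinearMap.inCoordinates, ContinuousLinearMap.comp_apply]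
  rw [Trivialization.symmL_continuousLinearMapAt _ hb]
  simp [fieldMomentum]

theorem ContMDiff.differentiableAt_chartField [CompleteSpace E]
    {X : ∀ g : G, TangentSpace 𝓘(ℝ, E) g}
    (hX : ContMDiff 𝓘(ℝ, E) 𝓘(ℝ, E).tangent 1 (fun g => (X g : TangentBundle 𝓘(ℝ, E) G)))
    (g₀ : G) : DifferentiableAt ℝ (chartField g₀ X) (extChartAt 𝓘(ℝ, E) g₀ g₀) := by
  have : IsManifold 𝓘(ℝ, E) 2 G := inferInstance
  have h : DifferentiableWithinAt ℝ (chartField g₀ X) ((extChartAt 𝓘(ℝ, E) g₀).symm ⁻¹' Set.univ ∩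
      Set.range 𝓘(ℝ, E)) (extChartAt 𝓘(ℝ, E) g₀ g₀) :=
    MDifferentiableWithinAt.differentiableWithinAt_mpullbackWithin_vectorField
      (s := Set.univ) (V := X) (hX.mdifferentiable one_ne_zero g₀).mdifferentiableWithinAt
  rwa [Set.preimage_univ, Set.univ_inter, modelWithCornersSelf_coe, Set.range_id,
    differentiableWithinAt_univ] at h

/-- The preferred chart has identity derivative at its own base point, in the identification of the
tangent space with `E`, so it leaves the covector of `x` unchanged. -/
theorem extChartAt_cotangent_self (x : CotangentBundle E G) :
    extChartAt (cotangentModel E) x x = (extChartAt 𝓘(ℝ, E) x.proj x.proj, covector x) := by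
  rw [FiberBundle.extChartAt]
  refine Prod.ext rfl ?_
  change ContinuousLinearMap.inCoordinates E (TangentSpace 𝓘(ℝ, E)) ℝ (Trivial G ℝ)
        x.proj x.proj x.proj x.proj x.snd = covector x
  ext v
  have hb : x.proj ∈ (chartAt E x.proj).source := mem_chart_source E x.proj
  have h1 := DFunLike.congr_fun (TangentBundle.symmL_trivializationAt (I := 𝓘(ℝ, E)) hb) v
  have h2 := DFunLike.congr_fun (mfderivWithin_range_extChartAt_symm (I := 𝓘(ℝ, E)) (x := x.proj)) v
  simp only [ContinuousLinearMap.inCoordinates, ContinuousLinearMap.comp_apply]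
  refine Eq.trans ?_ (congrArg (covector x) (h1.trans h2))
  simp
  rfl

theorem hasMFDerivAt_fieldMomentum [CompleteSpace E] {X : ∀ g : G, TangentSpace 𝓘(ℝ, E) g}
    (hX : ContMDiff 𝓘(ℝ, E) 𝓘(ℝ, E).tangent 1 (fun g => (X g : TangentBundle 𝓘(ℝ, E) G)))
    (x : CotangentBundle E G) :
    HasMFDerivAt (cotangentModel E) 𝓘(ℝ, ℝ) (fieldMomentum X) x
      (((covector x).comp (fderiv ℝ (chartField x.proj X)
        (extChartAt 𝓘(ℝ, E) x.proj x.proj))).coprod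
        (ContinuousLinearMap.apply ℝ ℝ (chartField x.proj X
          (extChartAt 𝓘(ℝ, E) x.proj x.proj)))) := by
  have hd := (ContMDiff.differentiableAt_chartField hX x.proj).hasFDerivAt
  have hK : HasFDerivAt (fun z : E × (E →L[ℝ] ℝ) => z.2 (chartField x.proj X z.1))
      (((covector x).comp (fderiv ℝ (chartField x.proj X)
        (extChartAt 𝓘(ℝ, E) x.proj x.proj))).coprod
        (ContinuousLinearMap.apply ℝ ℝ (chartField x.proj X
          (extChartAt 𝓘(ℝ, E) x.proj x.proj))))
      (extChartAt (cotangentModel E) x x) := by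
    rw [extChartAt_cotangent_self]
    have := (hasFDerivAt_snd (𝕜 := ℝ)
      (p := (extChartAt 𝓘(ℝ, E) x.proj x.proj, covector x))).clm_apply
      (hd.comp (extChartAt 𝓘(ℝ, E) x.proj x.proj, covector x) hasFDerivAt_fst)
    refine this.congr_fderiv ?_
    ext v <;> simp
  have : IsManifold (cotangentModel E) 1 (CotangentBundle E G) := inferInstance
  have h2 := hK.hasMFDerivAt.comp x
    (mdifferentiableAt_extChartAt (I := cotangentModel E) (mem_chart_source _ x)).hasMFDerivAt
  rw [mfderiv_extChartAt_self] at h2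
  refine HasMFDerivAt.congr_of_eventuallyEq (f' := _) h2 ?_
  have hn : ∀ᶠ y : CotangentBundle E G in 𝓝 x, y.proj ∈ (chartAt E x.proj).source :=
    (FiberBundle.continuous_proj (E →L[ℝ] ℝ) _).continuousAt
      ((chartAt E x.proj).open_source.mem_nhds (mem_chart_source E x.proj))
  filter_upwards [hn] with y hy
  exact fieldMomentum_eq_chart x y hy X

theorem cotangentDiff_fieldMomentum [CompleteSpace E] {X : ∀ g : G, TangentSpace 𝓘(ℝ, E) g}
    (hX : ContMDiff 𝓘(ℝ, E) 𝓘(ℝ, E).tangent 1 (fun g => (X g : TangentBundle 𝓘(ℝ, E) G)))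
    (x : CotangentBundle E G) (v : E) (δ : E →L[ℝ] ℝ) :
    cotangentDiff (fieldMomentum X) x (v, δ) =
      covector x (fderiv ℝ (chartField x.proj X) (extChartAt 𝓘(ℝ, E) x.proj x.proj) v) +
        δ (chartField x.proj X (extChartAt 𝓘(ℝ, E) x.proj x.proj)) := by
  rw [cotangentDiff, (hasMFDerivAt_fieldMomentum hX x).mfderiv]
  rfl

theorem momentumGradient_fieldMomentum [FiniteDimensional ℝ E]
    {X : ∀ g : G, TangentSpace 𝓘(ℝ, E) g}
    (hX : ContMDiff 𝓘(ℝ, E) 𝓘(ℝ, E).tangent 1 (fun g => (X g : TangentBundle 𝓘(ℝ, E) G)))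
    (x : CotangentBundle E G) :
    momentumGradient (fieldMomentum X) x =
      chartField x.proj X (extChartAt 𝓘(ℝ, E) x.proj x.proj) := by
  have : CompleteSpace E := FiniteDimensional.complete ℝ E
  refine (SeparatingDual.eq_iff_forall_dual_eq (R := ℝ)).2 fun δ => ?_
  rw [momentumGradient, apply_bidualVector]
  change cotangentDiff (fieldMomentum X) x (0, δ) = _
  simp [cotangentDiff_fieldMomentum hX]

/-- The manifold bracket is the bracket in the preferred chart pulled back by the chart derivative,
and that derivative is the identity at the centre. -/
theorem mlieBracket_eq_chartField (X W : ∀ g : G, TangentSpace 𝓘(ℝ, E) g) (g : G) :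
    (mlieBracket 𝓘(ℝ, E) X W g : E) =
      lieBracket ℝ (chartField g X) (chartField g W) (extChartAt 𝓘(ℝ, E) g g) := by
  have : IsManifold 𝓘(ℝ, E) 1 G := inferInstance
  have h : (mfderiv 𝓘(ℝ, E) 𝓘(ℝ, E) (extChartAt 𝓘(ℝ, E) g) g).inverse
      = ContinuousLinearMap.id ℝ E := by
    rw [mfderiv_extChartAt_self]
    exact ContinuousLinearMap.inverse_id
  rw [mlieBracket]
  refine (DFunLike.congr_fun h _).trans ?_
  change lieBracketWithin ℝ (chartField g X) (chartField g W)
    ((extChartAt 𝓘(ℝ, E) g).symm ⁻¹' Set.univ ∩ Set.range 𝓘(ℝ, E)) (extChartAt 𝓘(ℝ, E) g g) = _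
  rw [Set.preimage_univ, Set.univ_inter, modelWithCornersSelf_coe, Set.range_id,
    lieBracketWithin_univ]

/-- The Poisson bracket of two functions linear on the fibres is minus the Lie bracket of the
corresponding vector fields. -/
theorem poissonBracket_fieldMomentum [FiniteDimensional ℝ E]
    {X W : ∀ g : G, TangentSpace 𝓘(ℝ, E) g}
    (hX : ContMDiff 𝓘(ℝ, E) 𝓘(ℝ, E).tangent 1 (fun g => (X g : TangentBundle 𝓘(ℝ, E) G)))
    (hW : ContMDiff 𝓘(ℝ, E) 𝓘(ℝ, E).tangent 1 (fun g => (W g : TangentBundle 𝓘(ℝ, E) G)))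
    (x : CotangentBundle E G) :
    poissonBracket (fieldMomentum X) (fieldMomentum W) x =
      - covector x (mlieBracket 𝓘(ℝ, E) X W x.proj) := by
  have : CompleteSpace E := FiniteDimensional.complete ℝ E
  have h := congrArg (covector x) (mlieBracket_eq_chartField X W x.proj)
  rw [poissonBracket, momentumGradient_fieldMomentum hX, momentumGradient_fieldMomentum hW,
    cotangentDiff_fieldMomentum hX, cotangentDiff_fieldMomentum hW]
  refine Eq.trans ?_ (congrArg Neg.neg h.symm)
  simp [lieBracket]

theorem ContMDiff.isSmoothOnCotangent_fieldMomentum {X : ∀ g : G, TangentSpace 𝓘(ℝ, E) g}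
    (hX : ContMDiff 𝓘(ℝ, E) 𝓘(ℝ, E).tangent ∞ (fun g => (X g : TangentBundle 𝓘(ℝ, E) G))) :
    IsSmoothOnCotangent (fieldMomentum X) := by
  intro x
  have h := ContMDiffAt.clm_bundle_apply (n := ∞) (x := x) (M := CotangentBundle E G)
    (IM := cotangentModel E) (IB := 𝓘(ℝ, E)) (F₁ := E) (E₁ := TangentSpace 𝓘(ℝ, E))
    (F₂ := ℝ) (E₂ := Trivial G ℝ) (b := fun y => y.proj) (ϕ := fun y => y.snd)
    (v := fun y => X y.proj) contMDiffAt_id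
    (hX.contMDiffAt.comp x (contMDiffAt_proj _))
  exact (contMDiffAt_totalSpace.1 h).2

end FieldMomentum
end

/-! ### Left- and right-invariant vector fields and their Lie brackets. -/

noncomputable section

section InvariantFields

open VectorField Filter Topology

variable (E : Type*) [NormedAddCommGroup E] [NormedSpace ℝ E]
  {G : Type*} [TopologicalSpace G] [ChartedSpace E G]

/-- The differential of a self-map of `G`, as an endomorphism of the model space. -/
def modelDeriv (f : G → G) (g : G) : E →L[ℝ] E := mfderiv 𝓘(ℝ, E) 𝓘(ℝ, E) f g

variable {E}

theorem modelDeriv_comp {f k : G → G} {g : G}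
    (hf : MDifferentiableAt 𝓘(ℝ, E) 𝓘(ℝ, E) f (k g))
    (hk : MDifferentiableAt 𝓘(ℝ, E) 𝓘(ℝ, E) k g) :
    modelDeriv E (fun y => f (k y)) g = (modelDeriv E f (k g)).comp (modelDeriv E k g) :=
  mfderiv_comp g hf hk

theorem modelDeriv_id (g : G) : modelDeriv E (fun y => y) g = ContinuousLinearMap.id ℝ E :=
  mfderiv_id

theorem modelDeriv_const (c g : G) : modelDeriv E (fun _ => c) g = 0 :=
  mfderiv_const

theorem tangentBundle_mk_congr {g g' : G} (h : g = g') {v w : E} (hvw : v = w) :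
    TotalSpace.mk (F := E) (E := TangentSpace 𝓘(ℝ, E)) g v = TotalSpace.mk g' w := by
  subst h hvw; rfl

variable [Group G]

/-- The differential `d(L_g)₁`. -/
def leftDeriv (g : G) : E →L[ℝ] E := modelDeriv E (fun y : G => g * y) 1

/-- The differential `d(R_g)₁`. -/
def rightDeriv (g : G) : E →L[ℝ] E := modelDeriv E (fun y : G => y * g) 1

/-- The left-invariant vector field `g ↦ d(L_g)₁ η`. -/
def leftField (η : E) (g : G) : TangentSpace 𝓘(ℝ, E) g :=
  DFunLike.coe (F := E →L[ℝ] E) (leftDeriv g) η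

/-- The right-invariant vector field `g ↦ d(R_g)₁ ξ`. -/
def rightField (ξ : E) (g : G) : TangentSpace 𝓘(ℝ, E) g :=
  DFunLike.coe (F := E →L[ℝ] E) (rightDeriv g) ξ

variable [LieGroup 𝓘(ℝ, E) ∞ G]

theorem lieGroup_minSmoothness : LieGroup 𝓘(ℝ, E) (minSmoothness ℝ 3) G := by
  rw [minSmoothness_of_isRCLikeNormedField]
  infer_instance

theorem mdifferentiable_group_mul_left (a : G) :
    MDifferentiable 𝓘(ℝ, E) 𝓘(ℝ, E) (fun y : G => a * y) :=
  (contMDiff_mul_left (I := 𝓘(ℝ, E)) (n := ∞)).mdifferentiable (by simp)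

theorem mdifferentiable_group_mul_right (a : G) :
    MDifferentiable 𝓘(ℝ, E) 𝓘(ℝ, E) (fun y : G => y * a) :=
  (contMDiff_mul_right (I := 𝓘(ℝ, E)) (n := ∞)).mdifferentiable (by simp)

theorem mdifferentiable_group_inv :
    MDifferentiable 𝓘(ℝ, E) 𝓘(ℝ, E) (fun y : G => y⁻¹) :=
  (contMDiff_inv 𝓘(ℝ, E) ∞).mdifferentiable (by simp)

/-- Invariant fields are the tangent map of multiplication applied to the zero section and a
constant vector at the identity; their smoothness follows from this one statement. -/
theorem contMDiff_mul_tangent {p q : G → TangentBundle 𝓘(ℝ, E) G}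
    (hp : ContMDiff 𝓘(ℝ, E) 𝓘(ℝ, E).tangent ∞ p) (hq : ContMDiff 𝓘(ℝ, E) 𝓘(ℝ, E).tangent ∞ q) :
    ContMDiff 𝓘(ℝ, E) 𝓘(ℝ, E).tangent ∞ (fun g =>
      tangentMap (𝓘(ℝ, E).prod 𝓘(ℝ, E)) 𝓘(ℝ, E) (fun z : G × G => z.1 * z.2)
        ((equivTangentBundleProd 𝓘(ℝ, E) G 𝓘(ℝ, E) G).symm (p g, q g))) := by
  refine ContMDiff.comp
    (ContMDiff.contMDiff_tangentMap (n := ∞) (contMDiff_mul 𝓘(ℝ, E) ∞) (by simp)) ?_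
  exact contMDiff_equivTangentBundleProd_symm.comp (hp.prodMk hq)

theorem mfderiv_mul_apply (a b : G) (u v : E) :
    DFunLike.coe (F := E × E →L[ℝ] E)
      (mfderiv (𝓘(ℝ, E).prod 𝓘(ℝ, E)) 𝓘(ℝ, E) (fun z : G × G => z.1 * z.2) (a, b)) (u, v) =
    modelDeriv E (fun y : G => y * b) a u + modelDeriv E (fun y : G => a * y) b v :=
  mfderiv_prod_eq_add_apply (I := 𝓘(ℝ, E)) (I' := 𝓘(ℝ, E)) (I'' := 𝓘(ℝ, E))
    (f := fun z : G × G => z.1 * z.2) (p := (a, b)) (v := (u, v))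
    ((contMDiff_mul 𝓘(ℝ, E) ∞).mdifferentiableAt (by simp))

theorem contMDiff_leftField (η : E) : ContMDiff 𝓘(ℝ, E) 𝓘(ℝ, E).tangent ∞
    (fun g : G => (leftField η g : TangentBundle 𝓘(ℝ, E) G)) := by
  have h := contMDiff_mul_tangent (E := E) (G := G) (p := fun g => TotalSpace.mk' E g 0)
    (q := fun _ => TotalSpace.mk' E 1 η) (contMDiff_zeroSection _ _) contMDiff_const
  refine h.congr fun g => ?_
  refine tangentBundle_mk_congr (mul_one g).symm ?_
  refine Eq.trans ?_ (mfderiv_mul_apply g 1 (0 : E) η).symm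
  rw [map_zero, zero_add]
  rfl

theorem contMDiff_rightField (ξ : E) : ContMDiff 𝓘(ℝ, E) 𝓘(ℝ, E).tangent ∞
    (fun g : G => (rightField ξ g : TangentBundle 𝓘(ℝ, E) G)) := by
  have h := contMDiff_mul_tangent (E := E) (G := G) (q := fun g => TotalSpace.mk' E g 0)
    (p := fun _ => TotalSpace.mk' E 1 ξ) contMDiff_const (contMDiff_zeroSection _ _)
  refine h.congr fun g => ?_
  refine tangentBundle_mk_congr (one_mul g).symm ?_
  refine Eq.trans ?_ (mfderiv_mul_apply 1 g ξ (0 : E)).symm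
  rw [map_zero, add_zero]
  rfl

theorem mlieBracket_leftField [CompleteSpace E] (η ζ : E) (g : G) :
    mlieBracket 𝓘(ℝ, E) (leftField η) (leftField ζ) g = leftField (algBracket G η ζ) g := by
  have := lieGroup_minSmoothness (E := E) (G := G)
  exact (congrFun (mulInvariantVector_mlieBracket (I := 𝓘(ℝ, E)) (G := G) η ζ) g).symm

/-- Differentiate the constant map `y ↦ y * y⁻¹` at the identity. -/
theorem modelDeriv_inv_one : modelDeriv E (fun y : G => y⁻¹) 1 = -ContinuousLinearMap.id ℝ E := by
  ext v
  have hm : MDifferentiableAt (𝓘(ℝ, E).prod 𝓘(ℝ, E)) 𝓘(ℝ, E) (fun z : G × G => z.1 * z.2)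
    (1, 1⁻¹) := (contMDiff_mul 𝓘(ℝ, E) ∞).mdifferentiableAt (by simp)
  have h2 := hm.hasMFDerivAt.comp (1 : G) ((hasMFDerivAt_id (1 : G)).prodMk
    (mdifferentiable_group_inv (1 : G)).hasMFDerivAt)
  have h1 : modelDeriv E (fun y : G => y * y⁻¹) 1 v =
      modelDeriv E (fun y : G => y * 1⁻¹) 1 v +
        modelDeriv E (fun y : G => 1 * y) 1⁻¹ (modelDeriv E (fun y : G => y⁻¹) 1 v) :=
    (DFunLike.congr_fun h2.mfderiv v).trans (mfderiv_mul_apply (1 : G) (1⁻¹ : G) v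
      (modelDeriv E (fun y : G => y⁻¹) 1 v))
  simp only [mul_inv_cancel, modelDeriv_const, inv_one, mul_one, one_mul, modelDeriv_id,
    zero_apply, ContinuousLinearMap.id_apply] at h1
  exact eq_neg_of_add_eq_zero_right h1.symm

theorem modelDeriv_inv_comp_self (g : G) :
    (modelDeriv E (fun y : G => y⁻¹) g⁻¹).comp (modelDeriv E (fun y : G => y⁻¹) g) =
      ContinuousLinearMap.id ℝ E := by
  rw [← modelDeriv_comp (f := fun y : G => y⁻¹) (k := fun y : G => y⁻¹)
    (mdifferentiable_group_inv _) (mdifferentiable_group_inv _)]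
  simp only [inv_inv, modelDeriv_id]

/-- Inversion exchanges left and right translations and has derivative `-1` at the identity. This
transfers the bracket of left-invariant fields to right-invariant ones. -/
theorem mpullback_inv_leftField (η : E) :
    mpullback 𝓘(ℝ, E) 𝓘(ℝ, E) (fun y : G => y⁻¹) (leftField η) = rightField (-η) := by
  ext g
  have hinv : (modelDeriv E (fun y : G => y⁻¹) g).inverse =
      modelDeriv E (fun y : G => y⁻¹) g⁻¹ := by
    refine ContinuousLinearMap.inverse_eq ?_ (modelDeriv_inv_comp_self g)
    have := modelDeriv_inv_comp_self (E := E) (g⁻¹)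
    rwa [inv_inv] at this
  refine (DFunLike.congr_fun hinv (leftDeriv g⁻¹ η)).trans ?_
  have h1 := modelDeriv_comp (E := E) (f := fun y : G => y⁻¹) (k := fun y => g⁻¹ * y) (g := 1)
    (mdifferentiable_group_inv _) (mdifferentiable_group_mul_left _ _)
  have h2 := modelDeriv_comp (E := E) (f := fun y : G => y * g) (k := fun y => y⁻¹) (g := 1)
    (mdifferentiable_group_mul_right _ _) (mdifferentiable_group_inv _)
  have h3 : (fun y : G => (g⁻¹ * y)⁻¹) = fun y => y⁻¹ * g := by ext y; simp
  rw [h3, h2, mul_one, inv_one, modelDeriv_inv_one] at h1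
  exact (DFunLike.congr_fun h1 η).symm

section Bracket

variable [CompleteSpace E]

theorem algBracket_add_left (a b c : E) :
    algBracket G (a + b) c = algBracket G a c + algBracket G b c := by
  have := lieGroup_minSmoothness (E := E) (G := G)
  exact add_lie (L := GroupLieAlgebra 𝓘(ℝ, E) G) (M := GroupLieAlgebra 𝓘(ℝ, E) G) a b c

theorem algBracket_smul_left (t : ℝ) (a b : E) :
    algBracket G (t • a) b = t • algBracket G a b := by
  have := lieGroup_minSmoothness (E := E) (G := G)
  exact smul_lie (L := GroupLieAlgebra 𝓘(ℝ, E) G) (M := GroupLieAlgebra 𝓘(ℝ, E) G) t a b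

theorem algBracket_skew (a b : E) : -algBracket G b a = algBracket G a b := by
  have := lieGroup_minSmoothness (E := E) (G := G)
  exact lie_skew (L := GroupLieAlgebra 𝓘(ℝ, E) G) a b

theorem algBracket_leibniz (a b c : E) :
    algBracket G a (algBracket G b c) =
      algBracket G (algBracket G a b) c + algBracket G b (algBracket G a c) := by
  have := lieGroup_minSmoothness (E := E) (G := G)
  exact leibniz_lie (L₁ := GroupLieAlgebra 𝓘(ℝ, E) G) (L₂ := GroupLieAlgebra 𝓘(ℝ, E) G)
    (M := GroupLieAlgebra 𝓘(ℝ, E) G) a b c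

theorem algBracket_add_right (a b c : E) :
    algBracket G a (b + c) = algBracket G a b + algBracket G a c := by
  rw [← algBracket_skew, algBracket_add_left, neg_add, algBracket_skew, algBracket_skew]

theorem algBracket_smul_right (t : ℝ) (a b : E) :
    algBracket G a (t • b) = t • algBracket G a b := by
  rw [← algBracket_skew, algBracket_smul_left, ← smul_neg, algBracket_skew]

end Bracket

theorem mlieBracket_rightField [CompleteSpace E] (ξ ζ : E) (g : G) :
    mlieBracket 𝓘(ℝ, E) (rightField ξ) (rightField ζ) g = rightField (-algBracket G ξ ζ) g := by
  have : IsManifold 𝓘(ℝ, E) (minSmoothness ℝ 3) G := lieGroup_minSmoothness.toIsManifold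
  -- Naturality of the bracket under inversion. The two signs on the arguments cancel in the
  -- bracket; the sign from the final pullback survives.
  have h := mpullback_mlieBracket (n := ∞) (I := 𝓘(ℝ, E)) (I' := 𝓘(ℝ, E))
    (f := fun y : G => y⁻¹) (V := leftField (-ξ)) (W := leftField (-ζ)) (x₀ := g)
    ((contMDiff_leftField (-ξ)).mdifferentiable (by simp) _)
    ((contMDiff_leftField (-ζ)).mdifferentiable (by simp) _)
    (contMDiff_inv 𝓘(ℝ, E) ∞ g)
    (by rw [minSmoothness_of_isRCLikeNormedField]; exact ENat.LEInfty.out)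
  rw [mpullback_inv_leftField, mpullback_inv_leftField, neg_neg, neg_neg] at h
  have hf : mlieBracket 𝓘(ℝ, E) (leftField (G := G) (-ξ)) (leftField (-ζ)) =
      leftField (algBracket G ξ ζ) := by
    ext g'
    rw [mlieBracket_leftField, ← neg_one_smul ℝ ξ, ← neg_one_smul ℝ ζ, algBracket_smul_left,
      algBracket_smul_right, smul_smul]
    simp
  rw [← h, ← mpullback_inv_leftField, hf]

end InvariantFields
end

/-! ### Left- and right-invariant fields commute. -/

noncomputable section

section Commutation

open VectorField Filter Topology

variable {E : Type*} [NormedAddCommGroup E] [NormedSpace ℝ E]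
  {G : Type*} [TopologicalSpace G] [ChartedSpace E G]

theorem contMDiffAt_chart_symm [IsManifold 𝓘(ℝ, E) ∞ G] (g : G) : ContMDiffAt 𝓘(ℝ, E) 𝓘(ℝ, E) ∞
    (extChartAt 𝓘(ℝ, E) g).symm (extChartAt 𝓘(ℝ, E) g g) := by
  have h := contMDiffWithinAt_extChartAt_symm_range_self (I := 𝓘(ℝ, E)) (n := ∞) g
  rwa [modelWithCornersSelf_coe, Set.range_id, contMDiffWithinAt_univ] at h

theorem hasMFDerivAt_chart_symm [IsManifold 𝓘(ℝ, E) ∞ G] (g : G) : HasMFDerivAt 𝓘(ℝ, E) 𝓘(ℝ, E)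
    (extChartAt 𝓘(ℝ, E) g).symm (extChartAt 𝓘(ℝ, E) g g) (ContinuousLinearMap.id ℝ E) := by
  have : IsManifold 𝓘(ℝ, E) 1 G := inferInstance
  have h1 := ((contMDiffAt_chart_symm (E := E) g).mdifferentiableAt (by simp)).hasMFDerivAt
  have h2 := mfderivWithin_range_extChartAt_symm (I := 𝓘(ℝ, E)) (x := g)
  rw [modelWithCornersSelf_coe, Set.range_id, mfderivWithin_univ] at h2
  rw [h2] at h1
  exact h1

/-- The differential of the preferred chart at `g₀`, as an endomorphism of the model space. -/
def chartDeriv (g₀ g : G) : E →L[ℝ] E := mfderiv 𝓘(ℝ, E) 𝓘(ℝ, E) (extChartAt 𝓘(ℝ, E) g₀) g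

/-- The derivative of `a ↦ f a` read in the preferred charts at `1` and at `g₀`. -/
theorem hasFDerivAt_chart_comp [IsManifold 𝓘(ℝ, E) ∞ G] {f : G → G} {g₀ g h : G}
    (hf : MDifferentiableAt 𝓘(ℝ, E) 𝓘(ℝ, E) f g) (hh : f g = h)
    (hs : h ∈ (chartAt E g₀).source) :
    HasFDerivAt (fun a => extChartAt 𝓘(ℝ, E) g₀ (f ((extChartAt 𝓘(ℝ, E) g).symm a)))
      ((chartDeriv g₀ h).comp (modelDeriv E f g)) (extChartAt 𝓘(ℝ, E) g g) := by
  subst hh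
  have : IsManifold 𝓘(ℝ, E) 1 G := inferInstance
  let D : E →L[ℝ] E := (chartDeriv g₀ (f g)).comp (modelDeriv E f g)
  have h1 : HasMFDerivAt 𝓘(ℝ, E) 𝓘(ℝ, E) (fun y => extChartAt 𝓘(ℝ, E) g₀ (f y)) g D :=
    (mdifferentiableAt_extChartAt hs).hasMFDerivAt.comp g hf.hasMFDerivAt
  have h2 : (extChartAt 𝓘(ℝ, E) g).symm (extChartAt 𝓘(ℝ, E) g g) = g := extChartAt_to_inv g
  have h3 : HasMFDerivAt 𝓘(ℝ, E) 𝓘(ℝ, E) (fun y => extChartAt 𝓘(ℝ, E) g₀ (f y))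
      ((extChartAt 𝓘(ℝ, E) g).symm (extChartAt 𝓘(ℝ, E) g g)) D := by
    rw [h2]; exact h1
  exact (h3.comp _ (hasMFDerivAt_chart_symm g)).hasFDerivAt

variable [Group G]

/-- The two-sided translation `(a, b) ↦ a g₀ b` in the preferred charts at `1` and `g₀`. -/
def chartTranslation (g₀ : G) (z : E × E) : E :=
  extChartAt 𝓘(ℝ, E) g₀ ((extChartAt 𝓘(ℝ, E) (1 : G)).symm z.1 * g₀ *
    (extChartAt 𝓘(ℝ, E) (1 : G)).symm z.2)

variable [LieGroup 𝓘(ℝ, E) ∞ G]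

theorem contDiffAt_chartTranslation (g₀ : G) :
    ContDiffAt ℝ ∞ (chartTranslation (E := E) g₀)
      (extChartAt 𝓘(ℝ, E) (1 : G) 1, extChartAt 𝓘(ℝ, E) (1 : G) 1) := by
  rw [← contMDiffAt_iff_contDiffAt]
  have h1 : ContMDiffAt 𝓘(ℝ, E × E) 𝓘(ℝ, E) ∞
      (fun z : E × E => (extChartAt 𝓘(ℝ, E) (1 : G)).symm z.1 * g₀ *
        (extChartAt 𝓘(ℝ, E) (1 : G)).symm z.2)
      (extChartAt 𝓘(ℝ, E) (1 : G) 1, extChartAt 𝓘(ℝ, E) (1 : G) 1) := by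
    have hs := contMDiffAt_chart_symm (E := E) (1 : G)
    refine ContMDiffAt.mul (ContMDiffAt.mul ?_ contMDiffAt_const) ?_
    · exact ContMDiffAt.comp _ (by exact hs) contDiff_fst.contMDiff.contMDiffAt
    · exact ContMDiffAt.comp _ (by exact hs) contDiff_snd.contMDiff.contMDiffAt
  refine ContMDiffAt.comp (I' := 𝓘(ℝ, E)) _ ?_ h1
  have : (extChartAt 𝓘(ℝ, E) (1 : G)).symm (extChartAt 𝓘(ℝ, E) (1 : G) 1) * g₀ *
      (extChartAt 𝓘(ℝ, E) (1 : G)).symm (extChartAt 𝓘(ℝ, E) (1 : G) 1) = g₀ := by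
    rw [extChartAt_to_inv, one_mul, mul_one]
  rw [this]
  exact contMDiffAt_extChartAt

/-- Moving `a` through the identity in `a * h`, where `h = g₀ * b`, traces the right-invariant field
at `h`. The identity is needed for all nearby `b`, because it is differentiated again in `b`. -/
theorem eventually_fderiv_chartTranslation_left (g₀ : G) (ξ : E) :
    ∀ᶠ b in 𝓝 (extChartAt 𝓘(ℝ, E) (1 : G) 1),
      fderiv ℝ (chartTranslation g₀) (extChartAt 𝓘(ℝ, E) (1 : G) 1, b) (ξ, 0) =
        chartField g₀ (rightField ξ) (chartTranslation g₀ (extChartAt 𝓘(ℝ, E) (1 : G) 1, b)) := by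
  set e := extChartAt 𝓘(ℝ, E) (1 : G) 1 with he
  have he1 : (extChartAt 𝓘(ℝ, E) (1 : G)).symm e = 1 := extChartAt_to_inv (1 : G)
  have hd : ∀ᶠ z in 𝓝 (e, e), DifferentiableAt ℝ (chartTranslation (E := E) g₀) z := by
    have := ((contDiffAt_chartTranslation (E := E) g₀).of_le
      (m := 1) (by exact_mod_cast le_top)).eventually (by simp)
    filter_upwards [this] with z hz using hz.differentiableAt (by simp)
  have hc : Tendsto (fun b : E => (e, b)) (𝓝 e) (𝓝 (e, e)) := by
    rw [nhds_prod_eq]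
    exact (tendsto_const_nhds).prodMk tendsto_id
  have hs : ∀ᶠ b in 𝓝 e, g₀ * (extChartAt 𝓘(ℝ, E) (1 : G)).symm b ∈ (chartAt E g₀).source := by
    have h1 : ContinuousAt (fun b => g₀ * (extChartAt 𝓘(ℝ, E) (1 : G)).symm b) e := by
      have := (contMDiffAt_chart_symm (E := E) (1 : G)).continuousAt
      have : ContinuousMul G := continuousMul_of_contMDiffMul 𝓘(ℝ, E) ∞
      fun_prop
    refine h1 ((chartAt E g₀).open_source.mem_nhds ?_)
    simp only [he1, mul_one]
    exact mem_chart_source E g₀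
  filter_upwards [hc.eventually hd, hs] with b hb hsb
  set h := g₀ * (extChartAt 𝓘(ℝ, E) (1 : G)).symm b with hh
  have h1 := hasFDerivAt_chart_comp (E := E) (f := fun y : G => y * h) (g₀ := g₀) (g := 1) (h := h)
    (mdifferentiable_group_mul_right h 1) (one_mul h) hsb
  have h2 : HasFDerivAt (fun a => chartTranslation (E := E) g₀ (a, b))
      ((fderiv ℝ (chartTranslation g₀) (e, b)).comp (ContinuousLinearMap.inl ℝ E E)) e :=
    HasFDerivAt.comp (f := fun a => (a, b)) e hb.hasFDerivAt (hasFDerivAt_prodMk_left e b)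
  have h3 : (fun a => chartTranslation (E := E) g₀ (a, b)) = fun a => extChartAt 𝓘(ℝ, E) g₀
      ((extChartAt 𝓘(ℝ, E) (1 : G)).symm a * h) := by
    funext a; simp only [chartTranslation, hh, mul_assoc]
  rw [h3] at h2
  have h4 := DFunLike.congr_fun (h2.unique h1) ξ
  simp only [ContinuousLinearMap.comp_apply, ContinuousLinearMap.inl_apply] at h4
  rw [h4]
  have h5 : chartTranslation g₀ (e, b) = extChartAt 𝓘(ℝ, E) g₀ h := by
    simp only [chartTranslation, he1, one_mul, hh]
  rw [h5, chartField_apply hsb]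
  rfl

theorem eventually_fderiv_chartTranslation_right (g₀ : G) (η : E) :
    ∀ᶠ a in 𝓝 (extChartAt 𝓘(ℝ, E) (1 : G) 1),
      fderiv ℝ (chartTranslation g₀) (a, extChartAt 𝓘(ℝ, E) (1 : G) 1) (0, η) =
        chartField g₀ (leftField η) (chartTranslation g₀ (a, extChartAt 𝓘(ℝ, E) (1 : G) 1)) := by
  set e := extChartAt 𝓘(ℝ, E) (1 : G) 1 with he
  have he1 : (extChartAt 𝓘(ℝ, E) (1 : G)).symm e = 1 := extChartAt_to_inv (1 : G)
  have hd : ∀ᶠ z in 𝓝 (e, e), DifferentiableAt ℝ (chartTranslation (E := E) g₀) z := by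
    have := ((contDiffAt_chartTranslation (E := E) g₀).of_le
      (m := 1) (by exact_mod_cast le_top)).eventually (by simp)
    filter_upwards [this] with z hz using hz.differentiableAt (by simp)
  have hc : Tendsto (fun a : E => (a, e)) (𝓝 e) (𝓝 (e, e)) := by
    rw [nhds_prod_eq]
    exact tendsto_id.prodMk tendsto_const_nhds
  have hs : ∀ᶠ a in 𝓝 e, (extChartAt 𝓘(ℝ, E) (1 : G)).symm a * g₀ ∈ (chartAt E g₀).source := by
    have h1 : ContinuousAt (fun a => (extChartAt 𝓘(ℝ, E) (1 : G)).symm a * g₀) e := by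
      have := (contMDiffAt_chart_symm (E := E) (1 : G)).continuousAt
      have : ContinuousMul G := continuousMul_of_contMDiffMul 𝓘(ℝ, E) ∞
      fun_prop
    refine h1 ((chartAt E g₀).open_source.mem_nhds ?_)
    simp only [he1, one_mul]
    exact mem_chart_source E g₀
  filter_upwards [hc.eventually hd, hs] with a ha hsa
  set h := (extChartAt 𝓘(ℝ, E) (1 : G)).symm a * g₀ with hh
  have h1 := hasFDerivAt_chart_comp (E := E) (f := fun y : G => h * y) (g₀ := g₀) (g := 1) (h := h)
    (mdifferentiable_group_mul_left h 1) (mul_one h) hsa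
  have h2 : HasFDerivAt (fun b => chartTranslation (E := E) g₀ (a, b))
      ((fderiv ℝ (chartTranslation g₀) (a, e)).comp (ContinuousLinearMap.inr ℝ E E)) e :=
    ha.hasFDerivAt.comp e (hasFDerivAt_prodMk_right a e)
  have h4 := DFunLike.congr_fun (h2.unique h1) η
  simp only [ContinuousLinearMap.comp_apply, ContinuousLinearMap.inr_apply] at h4
  rw [h4]
  have h5 : chartTranslation g₀ (a, e) = extChartAt 𝓘(ℝ, E) g₀ h := by
    simp only [chartTranslation, he1, mul_one, hh]
  rw [h5, chartField_apply hsa]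
  rfl

/-- Left- and right-invariant vector fields commute. -/
theorem fderiv_chartField_comm [CompleteSpace E] (g₀ : G) (η ξ : E) :
    fderiv ℝ (chartField g₀ (rightField ξ)) (extChartAt 𝓘(ℝ, E) g₀ g₀)
      (chartField g₀ (leftField η) (extChartAt 𝓘(ℝ, E) g₀ g₀)) =
    fderiv ℝ (chartField g₀ (leftField η)) (extChartAt 𝓘(ℝ, E) g₀ g₀)
      (chartField g₀ (rightField ξ) (extChartAt 𝓘(ℝ, E) g₀ g₀)) := by
  set e := extChartAt 𝓘(ℝ, E) (1 : G) 1 with he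
  have he1 : (extChartAt 𝓘(ℝ, E) (1 : G)).symm e = 1 := extChartAt_to_inv (1 : G)
  have hN := contDiffAt_chartTranslation (E := E) g₀
  have h0 : chartTranslation g₀ (e, e) = extChartAt 𝓘(ℝ, E) g₀ g₀ := by
    simp only [chartTranslation, he1, mul_one, one_mul]
  have hD : HasFDerivAt (fderiv ℝ (chartTranslation (E := E) g₀))
      (fderiv ℝ (fderiv ℝ (chartTranslation (E := E) g₀)) (e, e)) (e, e) :=
    ((hN.fderiv_right (m := 1) (by rw [one_add_one_eq_two]; exact ENat.LEInfty.out)).differentiableAt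
      (by simp)).hasFDerivAt
  have hN1 : HasFDerivAt (chartTranslation (E := E) g₀)
      (fderiv ℝ (chartTranslation g₀) (e, e)) (e, e) :=
    (hN.differentiableAt (by simp)).hasFDerivAt
  have hR := (ContMDiff.differentiableAt_chartField
    ((contMDiff_rightField (G := G) ξ).of_le (by exact ENat.LEInfty.out)) g₀).hasFDerivAt
  have hL := (ContMDiff.differentiableAt_chartField
    ((contMDiff_leftField (G := G) η).of_le (by exact ENat.LEInfty.out)) g₀).hasFDerivAt
  have eR := eventually_fderiv_chartTranslation_left g₀ ξ
  have eL := eventually_fderiv_chartTranslation_right g₀ η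
  rw [← h0] at hR hL ⊢
  -- The `b`-derivative of `∂ₐN · ξ = R_ξ(N)` and the `a`-derivative of `∂_bN · η = L_η(N)`, with
  -- `N` the two-sided translation, express the mixed second derivatives of `N` through the two
  -- sides of the goal. Symmetry of the second derivative then equates them.
  have k1 := ((hD.comp e (hasFDerivAt_prodMk_right e e)).clm_apply
    (hasFDerivAt_const ((ξ, 0) : E × E) e)).congr_of_eventuallyEq
    (eR.mono fun b hb => hb.symm)
  have k2 := hR.comp e (hN1.comp e (hasFDerivAt_prodMk_right e e))
  have k3 := DFunLike.congr_fun (k1.unique k2) η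
  have l1 := ((HasFDerivAt.comp (f := fun a => (a, e)) e hD (hasFDerivAt_prodMk_left e e)).clm_apply
    (hasFDerivAt_const ((0, η) : E × E) e)).congr_of_eventuallyEq
    (eL.mono fun b hb => hb.symm)
  have l2 := HasFDerivAt.comp (f := fun a => chartTranslation g₀ (a, e)) e hL
    (HasFDerivAt.comp (f := fun a => (a, e)) e hN1 (hasFDerivAt_prodMk_left e e))
  have l3 := DFunLike.congr_fun (l1.unique l2) ξ
  simp at k3 l3
  rw [← eR.self_of_nhds, ← eL.self_of_nhds, ← k3, ← l3]
  exact (hN.isSymmSndFDerivAt (by simp; exact ENat.LEInfty.out)) _ _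

theorem mlieBracket_leftField_rightField [CompleteSpace E] (η ξ : E) (g : G) :
    (mlieBracket 𝓘(ℝ, E) (leftField η) (rightField ξ) g : E) = 0 := by
  rw [mlieBracket_eq_chartField, lieBracket, fderiv_chartField_comm, sub_self]
  rfl

end Commutation
end

/-! ### The momentum maps `J_R` and `J_L`: smoothness, brackets, submersivity and fibrewise
sections. -/

noncomputable section

section MomentumMaps

open VectorField Filter Topology

variable {E : Type*} [NormedAddCommGroup E] [NormedSpace ℝ E]
  {G : Type*} [TopologicalSpace G] [ChartedSpace E G]

/-- The Poisson bracket as a bivector: its value on two covectors of `E × E*`. -/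
def poissonBivector [FiniteDimensional ℝ E] (α β : (E × (E →L[ℝ] ℝ)) →L[ℝ] ℝ) : ℝ :=
  α (bidualVector (β.comp (ContinuousLinearMap.inr ℝ E (E →L[ℝ] ℝ))), 0) -
    β (bidualVector (α.comp (ContinuousLinearMap.inr ℝ E (E →L[ℝ] ℝ))), 0)

theorem bidualVector_add [FiniteDimensional ℝ E] (φ ψ : (E →L[ℝ] ℝ) →L[ℝ] ℝ) :
    bidualVector (φ + ψ) = bidualVector φ + bidualVector ψ := by
  simp [bidualVector, add_smul, Finset.sum_add_distrib]

theorem bidualVector_smul [FiniteDimensional ℝ E] (t : ℝ) (φ : (E →L[ℝ] ℝ) →L[ℝ] ℝ) :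
    bidualVector (t • φ) = t • bidualVector φ := by
  simp [bidualVector, Finset.smul_sum, smul_smul]

/-- The Poisson bivector is linear in its first argument. -/
def poissonBivectorLeft [FiniteDimensional ℝ E] (β : (E × (E →L[ℝ] ℝ)) →L[ℝ] ℝ) :
    ((E × (E →L[ℝ] ℝ)) →L[ℝ] ℝ) →ₗ[ℝ] ℝ where
  toFun α := poissonBivector α β
  map_add' α α' := by
    have h (v w : E) : ((v + w, 0) : E × (E →L[ℝ] ℝ)) = (v, 0) + (w, 0) := by simp
    simp only [poissonBivector, ContinuousLinearMap.add_comp, bidualVector_add, h, map_add,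
      add_apply]
    ring
  map_smul' t α := by
    have h (v : E) : ((t • v, 0) : E × (E →L[ℝ] ℝ)) = t • (v, 0) := by simp
    simp only [poissonBivector, ContinuousLinearMap.smul_comp, bidualVector_smul, h, map_smul,
      smul_apply, smul_eq_mul, RingHom.id_apply]
    ring

section Manifold

variable [IsManifold 𝓘(ℝ, E) ∞ G]

theorem poissonBracket_eq_bivector [FiniteDimensional ℝ E] (F K : CotangentBundle E G → ℝ)
    (x : CotangentBundle E G) :
    poissonBracket F K x = poissonBivectorLeft (cotangentDiff K x) (cotangentDiff F x) := rfl

/-- The point `(g, p)` of `T*G`. -/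
def cotangentPoint (g : G) (p : E →L[ℝ] ℝ) : CotangentBundle E G := TotalSpace.mk g p

theorem contMDiff_cotangentPoint (g : G) : ContMDiff 𝓘(ℝ, E →L[ℝ] ℝ) (cotangentModel E) ∞
    (cotangentPoint (E := E) g) := by
  intro p
  rw [contMDiffAt_totalSpace]
  refine ⟨contMDiffAt_const, ?_⟩
  have h : ∀ q : E →L[ℝ] ℝ, (trivializationAt (E →L[ℝ] ℝ)
      (fun g : G => TangentSpace 𝓘(ℝ, E) g →L[ℝ] Trivial G ℝ g) g
        (cotangentPoint g q)).2 = q := by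
    intro q
    have h1 := congrArg Prod.snd
      (extChartAt_cotangent_self (cotangentPoint g q))
    rw [FiberBundle.extChartAt] at h1
    exact h1
  exact contMDiffAt_id.congr_of_eventuallyEq (Eventually.of_forall h)

/-- A vector-valued map into `E*` is smooth when its components are. -/
theorem contMDiff_dual_of_apply [FiniteDimensional ℝ E] {J : CotangentBundle E G → E →L[ℝ] ℝ}
    (h : ∀ v, IsSmoothOnCotangent (fun x => J x v)) :
    ContMDiff (cotangentModel E) 𝓘(ℝ, E →L[ℝ] ℝ) ∞ J := by
  have hJ : J = fun x => ∑ i, J x (Module.finBasis ℝ E i) •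
      LinearMap.toContinuousLinearMap ((Module.finBasis ℝ E).coord i) := by
    funext x
    ext v
    conv_lhs => rw [← (Module.finBasis ℝ E).sum_repr v, map_sum]
    simp [-Module.Basis.sum_repr, mul_comm]
  rw [hJ]
  exact contMDiff_finsetSum fun i _ => (h _).smul contMDiff_const

theorem cotangentDiff_comp_dual [FiniteDimensional ℝ E] {J : CotangentBundle E G → E →L[ℝ] ℝ}
    (hJ : ContMDiff (cotangentModel E) 𝓘(ℝ, E →L[ℝ] ℝ) ∞ J) {f : (E →L[ℝ] ℝ) → ℝ}
    {x : CotangentBundle E G} (hf : DifferentiableAt ℝ f (J x)) :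
    cotangentDiff (fun y => f (J y)) x =
      cotangentDiff (fun y => J y (bidualVector (fderiv ℝ f (J x)))) x := by
  have hJx := (hJ.mdifferentiable (by simp) x).hasMFDerivAt
  set w := bidualVector (fderiv ℝ f (J x)) with hw
  have h1 : HasMFDerivAt (cotangentModel E) 𝓘(ℝ, ℝ) (fun y => f (J y)) x _ :=
    hf.hasFDerivAt.hasMFDerivAt.comp x hJx
  have h2 : HasMFDerivAt (cotangentModel E) 𝓘(ℝ, ℝ) (fun y => J y w) x _ :=
    (ContinuousLinearMap.apply ℝ ℝ w).hasFDerivAt.hasMFDerivAt.comp x hJx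
  rw [cotangentDiff, cotangentDiff, h1.mfderiv, h2.mfderiv]
  have h3 : fderiv ℝ f (J x) = ContinuousLinearMap.apply ℝ ℝ w := by
    ext μ
    rw [ContinuousLinearMap.apply_apply, hw, apply_bidualVector]
  rw [h3]
  rfl

/-- The differential of `⟨J, w⟩`, as a linear function of `w`. -/
def componentDiff (J : CotangentBundle E G → E →L[ℝ] ℝ) (x : CotangentBundle E G) :
    E →ₗ[ℝ] ((E × (E →L[ℝ] ℝ)) →L[ℝ] ℝ) :=
  (ContinuousLinearMap.flip (show (E × (E →L[ℝ] ℝ)) →L[ℝ] (E →L[ℝ] ℝ) from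
    mfderiv (cotangentModel E) 𝓘(ℝ, E →L[ℝ] ℝ) J x)).toLinearMap

theorem componentDiff_apply {J : CotangentBundle E G → E →L[ℝ] ℝ}
    (hJ : ContMDiff (cotangentModel E) 𝓘(ℝ, E →L[ℝ] ℝ) ∞ J) (x : CotangentBundle E G) (w : E) :
    componentDiff J x w = cotangentDiff (fun y => J y w) x := by
  have hJx := (hJ.mdifferentiable (by simp) x).hasMFDerivAt
  have h2 : HasMFDerivAt (cotangentModel E) 𝓘(ℝ, ℝ) (fun y => J y w) x _ :=
    (ContinuousLinearMap.apply ℝ ℝ w).hasFDerivAt.hasMFDerivAt.comp x hJx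
  rw [cotangentDiff, h2.mfderiv]
  rfl

/-- The chain rule, with the differential of `f` read as a vector of `𝔤`. Brackets of functions of
the momentum maps thereby reduce to the bivector on `componentDiff`. -/
theorem cotangentDiff_comp [FiniteDimensional ℝ E] {J : CotangentBundle E G → E →L[ℝ] ℝ}
    (hJ : ContMDiff (cotangentModel E) 𝓘(ℝ, E →L[ℝ] ℝ) ∞ J) {f : (E →L[ℝ] ℝ) → ℝ}
    {x : CotangentBundle E G} (hf : DifferentiableAt ℝ f (J x)) :
    cotangentDiff (fun y => f (J y)) x =
      componentDiff J x (bidualVector (fderiv ℝ f (J x))) := by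
  rw [cotangentDiff_comp_dual hJ hf, componentDiff_apply hJ]

end Manifold

variable [Group G] [LieGroup 𝓘(ℝ, E) ∞ G]

/-- `d(L_g)₁` is invertible. -/
def leftEquiv (g : G) : E ≃L[ℝ] E :=
  ContinuousLinearEquiv.equivOfInverse (leftDeriv g) (modelDeriv E (fun y : G => g⁻¹ * y) g)
    (fun v => by
      have h := modelDeriv_comp (E := E) (f := fun y : G => g⁻¹ * y) (k := fun y => g * y) (g := 1)
        (mdifferentiable_group_mul_left _ _) (mdifferentiable_group_mul_left _ _)
      simp only [inv_mul_cancel_left, modelDeriv_id, mul_one] at h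
      exact (DFunLike.congr_fun h v).symm)
    (fun v => by
      have h := modelDeriv_comp (E := E) (f := fun y : G => g * y) (k := fun y => g⁻¹ * y) (g := g)
        (mdifferentiable_group_mul_left _ _) (mdifferentiable_group_mul_left _ _)
      simp only [mul_inv_cancel_left, modelDeriv_id, inv_mul_cancel] at h
      exact (DFunLike.congr_fun h v).symm)

/-- `d(R_g)₁` is invertible. -/
def rightEquiv (g : G) : E ≃L[ℝ] E :=
  ContinuousLinearEquiv.equivOfInverse (rightDeriv g) (modelDeriv E (fun y : G => y * g⁻¹) g)
    (fun v => by
      have h := modelDeriv_comp (E := E) (f := fun y : G => y * g⁻¹) (k := fun y => y * g) (g := 1)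
        (mdifferentiable_group_mul_right _ _) (mdifferentiable_group_mul_right _ _)
      simp only [mul_inv_cancel_right, modelDeriv_id, one_mul] at h
      exact (DFunLike.congr_fun h v).symm)
    (fun v => by
      have h := modelDeriv_comp (E := E) (f := fun y : G => y * g) (k := fun y => y * g⁻¹) (g := g)
        (mdifferentiable_group_mul_right _ _) (mdifferentiable_group_mul_right _ _)
      simp only [inv_mul_cancel_right, modelDeriv_id, mul_inv_cancel] at h
      exact (DFunLike.congr_fun h v).symm)

/-- On the fibre through `x` the map `J` is a linear isomorphism, so it has a continuous section
through `x`, which carries points of `S` near `J x` to points of the preimage near `x`. -/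
theorem mem_closure_preimage_of_fibrewise {J : CotangentBundle E G → E →L[ℝ] ℝ}
    {x : CotangentBundle E G} (e : E ≃L[ℝ] E)
    (he : ∀ p : E →L[ℝ] ℝ, J (cotangentPoint x.proj p) = p.comp (e : E →L[ℝ] E))
    {S : Set (E →L[ℝ] ℝ)} (hx : J x ∈ closure S) : x ∈ closure (J ⁻¹' S) := by
  let s : (E →L[ℝ] ℝ) → CotangentBundle E G := fun ν =>
    cotangentPoint x.proj (ν.comp (e.symm : E →L[ℝ] E))
  have hs : Continuous s := (contMDiff_cotangentPoint x.proj).continuous.comp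
    (ContinuousLinearMap.precomp ℝ (e.symm : E →L[ℝ] E)).continuous
  have hJs : ∀ ν, J (s ν) = ν := by
    intro ν
    rw [he]
    ext v
    simp
  have hsx : s (J x) = x := by
    have h1 : J x = (covector x).comp (e : E →L[ℝ] E) := he (covector x)
    have h2 : (J x).comp (e.symm : E →L[ℝ] E) = covector x := by
      rw [h1]; ext v; simp
    simp only [s]
    rw [h2]
    rfl
  rw [← hsx]
  refine closure_mono ?_ (hs.continuousAt.continuousWithinAt.mem_closure_image hx)
  rintro _ ⟨ν, hν, rfl⟩
  simpa [hJs] using hν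

theorem mem_closure_rightMomentum_preimage {x : CotangentBundle E G} {S : Set (E →L[ℝ] ℝ)}
    (hx : rightMomentum x ∈ closure S) : x ∈ closure (rightMomentum ⁻¹' S) :=
  mem_closure_preimage_of_fibrewise (leftEquiv x.proj) (fun _ => rfl) hx

theorem mem_closure_leftMomentum_preimage {x : CotangentBundle E G} {S : Set (E →L[ℝ] ℝ)}
    (hx : leftMomentum x ∈ closure S) : x ∈ closure (leftMomentum ⁻¹' S) :=
  mem_closure_preimage_of_fibrewise (rightEquiv x.proj) (fun _ => rfl) hx

theorem dense_rightMomentum_preimage {S : Set (E →L[ℝ] ℝ)} (hS : Dense S) :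
    Dense (rightMomentum ⁻¹' S : Set (CotangentBundle E G)) := fun _ =>
  mem_closure_rightMomentum_preimage (hS _)

theorem dense_leftMomentum_preimage {S : Set (E →L[ℝ] ℝ)} (hS : Dense S) :
    Dense (leftMomentum ⁻¹' S : Set (CotangentBundle E G)) := fun _ =>
  mem_closure_leftMomentum_preimage (hS _)

/-- Invariance is applied with `a` the base point of `x` and `g` the identity. The transport between
`g * 1` and `g` is not definitional and is handled by `h`. -/
theorem isLeftInvariant_eq {H : CotangentBundle E G → ℝ} (hinv : IsLeftInvariant H)
    (x : CotangentBundle E G) :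
    H x = H (cotangentPoint (1 : G) (rightMomentum x)) := by
  have h : ∀ (g' : G) (_ : g' = x.proj), H (cotangentPoint g' (covector x)) = H x := by
    rintro g' rfl
    rfl
  exact (h _ (mul_one x.proj)).symm.trans (hinv x.proj 1 x.snd).symm

theorem contDiff_restrict_fibre {H : CotangentBundle E G → ℝ} (hH : IsSmoothOnCotangent H)
    (g : G) : ContDiff ℝ ∞ (fun μ : E →L[ℝ] ℝ => H (cotangentPoint g μ)) :=
  contMDiff_iff_contDiff.1 (ContMDiff.comp hH (contMDiff_cotangentPoint g))

variable [FiniteDimensional ℝ E]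

theorem contMDiff_rightMomentum :
    ContMDiff (cotangentModel E) 𝓘(ℝ, E →L[ℝ] ℝ) ∞ (rightMomentum : CotangentBundle E G → _) :=
  contMDiff_dual_of_apply fun v =>
    ContMDiff.isSmoothOnCotangent_fieldMomentum (contMDiff_leftField v)

theorem contMDiff_leftMomentum :
    ContMDiff (cotangentModel E) 𝓘(ℝ, E →L[ℝ] ℝ) ∞ (leftMomentum : CotangentBundle E G → _) :=
  contMDiff_dual_of_apply fun v =>
    ContMDiff.isSmoothOnCotangent_fieldMomentum (contMDiff_rightField v)

theorem poissonBracket_rightMomentum (η ζ : E) (x : CotangentBundle E G) :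
    poissonBracket (fun y => rightMomentum y η) (fun y => rightMomentum y ζ) x =
      - rightMomentum x (algBracket G η ζ) := by
  have : CompleteSpace E := FiniteDimensional.complete ℝ E
  refine (poissonBracket_fieldMomentum
    ((contMDiff_leftField (G := G) η).of_le (by exact ENat.LEInfty.out))
    ((contMDiff_leftField (G := G) ζ).of_le (by exact ENat.LEInfty.out)) x).trans ?_
  exact congrArg (fun v : E => - covector x v) (mlieBracket_leftField η ζ x.proj)

theorem poissonBracket_leftMomentum (ξ ζ : E) (x : CotangentBundle E G) :
    poissonBracket (fun y => leftMomentum y ξ) (fun y => leftMomentum y ζ) x =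
      leftMomentum x (algBracket G ξ ζ) := by
  have : CompleteSpace E := FiniteDimensional.complete ℝ E
  refine (poissonBracket_fieldMomentum
    ((contMDiff_rightField (G := G) ξ).of_le (by exact ENat.LEInfty.out))
    ((contMDiff_rightField (G := G) ζ).of_le (by exact ENat.LEInfty.out)) x).trans ?_
  refine (congrArg (fun v : E => - covector x v) (mlieBracket_rightField ξ ζ x.proj)).trans ?_
  change - leftMomentum x (-algBracket G ξ ζ) = _
  rw [map_neg, neg_neg]

theorem poissonBracket_rightMomentum_leftMomentum (η ξ : E) (x : CotangentBundle E G) :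
    poissonBracket (fun y => rightMomentum y η) (fun y => leftMomentum y ξ) x = 0 := by
  have : CompleteSpace E := FiniteDimensional.complete ℝ E
  refine (poissonBracket_fieldMomentum
    ((contMDiff_leftField (G := G) η).of_le (by exact ENat.LEInfty.out))
    ((contMDiff_rightField (G := G) ξ).of_le (by exact ENat.LEInfty.out)) x).trans ?_
  refine (congrArg (fun v : E => - covector x v)
    (mlieBracket_leftField_rightField η ξ x.proj)).trans ?_
  exact (congrArg Neg.neg (map_zero _)).trans neg_zero

/-- The fibre derivative of `⟨J_R, w⟩` is `d(L_g)₁ w`, and `d(L_g)₁` is invertible. Thus `J_R` is a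
submersion and independence of differentials can be checked in `𝔤`. -/
theorem eq_zero_of_componentDiff_rightMomentum {x : CotangentBundle E G} {w : E}
    (hw : componentDiff rightMomentum x w = 0) : w = 0 := by
  have : CompleteSpace E := FiniteDimensional.complete ℝ E
  rw [componentDiff_apply contMDiff_rightMomentum] at hw
  have h := momentumGradient_fieldMomentum
    ((contMDiff_leftField (G := G) w).of_le (by exact ENat.LEInfty.out)) x
  have h0 : momentumGradient (fieldMomentum (leftField w)) x = 0 := by
    change bidualVector ((cotangentDiff (fun y => rightMomentum y w) x).comp _) = 0
    rw [hw]
    simp [bidualVector]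
  rw [h0, chartField_self] at h
  exact (leftEquiv (E := E) x.proj).map_eq_zero_iff.1 h.symm

theorem eq_zero_of_componentDiff_leftMomentum {x : CotangentBundle E G} {w : E}
    (hw : componentDiff leftMomentum x w = 0) : w = 0 := by
  have : CompleteSpace E := FiniteDimensional.complete ℝ E
  rw [componentDiff_apply contMDiff_leftMomentum] at hw
  have h := momentumGradient_fieldMomentum
    ((contMDiff_rightField (G := G) w).of_le (by exact ENat.LEInfty.out)) x
  have h0 : momentumGradient (fieldMomentum (rightField w)) x = 0 := by
    change bidualVector ((cotangentDiff (fun y => leftMomentum y w) x).comp _) = 0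
    rw [hw]
    simp [bidualVector]
  rw [h0, chartField_self] at h
  exact (rightEquiv (E := E) x.proj).map_eq_zero_iff.1 h.symm

end MomentumMaps
end

/-! ### The dimension of a coadjoint orbit as the rank of `μ([·,·])`. -/

noncomputable section

section CoadjointOrbits

open VectorField Filter Topology

theorem differentiableAt_clm_of_apply {E F K : Type*} [NormedAddCommGroup E] [NormedSpace ℝ E]
    [FiniteDimensional ℝ E] [NormedAddCommGroup F] [NormedSpace ℝ F]
    [NormedAddCommGroup K] [NormedSpace ℝ K] {A : K → E →L[ℝ] F} {q : K}
    (h : ∀ v, DifferentiableAt ℝ (fun z => A z v) q) : DifferentiableAt ℝ A q := by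
  have hA : A = fun z => ∑ i, (LinearMap.toContinuousLinearMap
      ((Module.finBasis ℝ E).coord i)).smulRight (A z (Module.finBasis ℝ E i)) := by
    funext z
    ext v
    conv_lhs => rw [← (Module.finBasis ℝ E).sum_repr v, map_sum]
    simp [-Module.Basis.sum_repr]
  rw [hA]
  refine DifferentiableAt.fun_sum fun i _ => ?_
  exact (ContinuousLinearMap.smulRightL ℝ E F (LinearMap.toContinuousLinearMap
    ((Module.finBasis ℝ E).coord i))).differentiableAt.comp q (h _)

variable {E : Type*} [NormedAddCommGroup E] [NormedSpace ℝ E] [FiniteDimensional ℝ E]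
  {G : Type*} [TopologicalSpace G] [ChartedSpace E G] [Group G] [LieGroup 𝓘(ℝ, E) ∞ G]

variable (G) in
/-- The Lie bracket of `𝔤 = E` as a continuous bilinear map. -/
def algBracketCLM : E →L[ℝ] E →L[ℝ] E :=
  have : CompleteSpace E := FiniteDimensional.complete ℝ E
  LinearMap.toContinuousLinearMap ((LinearMap.toContinuousLinearMap (𝕜 := ℝ) (E := E)
    (F' := E)).toLinearMap ∘ₗ LinearMap.mk₂ ℝ (algBracket G) algBracket_add_left
      algBracket_smul_left algBracket_add_right algBracket_smul_right)

theorem algBracketCLM_apply (a b : E) : algBracketCLM G a b = algBracket G a b := rfl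

theorem leftDeriv_comp_adjointMap (g : G) :
    (leftDeriv g).comp (adjointMap g⁻¹) = (rightDeriv g : E →L[ℝ] E) := by
  have h := modelDeriv_comp (E := E) (f := fun y : G => g * y) (k := fun y => g⁻¹ * y * g⁻¹⁻¹)
    (g := 1) (mdifferentiable_group_mul_left _ _)
    ((mdifferentiable_group_mul_right _ _).comp _ (mdifferentiable_group_mul_left _ _))
  have h1 : (fun y : G => g * (g⁻¹ * y * g⁻¹⁻¹)) = fun y => y * g := by
    funext y; group
  have h2 : g⁻¹ * 1 * g⁻¹⁻¹ = 1 := by group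
  rw [h1, h2] at h
  exact h.symm

/-- The derivative at the identity of `g ↦ Ad_{g⁻¹}`, read in the preferred chart. -/
theorem exists_hasFDerivAt_adjointMap : ∃ A' : E →L[ℝ] E →L[ℝ] E,
    (∀ ζ ξ, A' ζ ξ = algBracket G ξ ζ) ∧
    HasFDerivAt (fun q => adjointMap ((extChartAt 𝓘(ℝ, E) (1 : G)).symm q)⁻¹) A'
      (extChartAt 𝓘(ℝ, E) (1 : G) 1) := by
  have : CompleteSpace E := FiniteDimensional.complete ℝ E
  set φ := extChartAt 𝓘(ℝ, E) (1 : G) with hφ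
  set e := φ 1 with he
  have he1 : φ.symm e = 1 := extChartAt_to_inv (1 : G)
  let V : E → E →L[ℝ] E := fun q => (chartDeriv 1 (φ.symm q)).comp (leftDeriv (φ.symm q))
  let Y : E → E →L[ℝ] E := fun q => (chartDeriv 1 (φ.symm q)).comp (rightDeriv (φ.symm q))
  let A : E → E →L[ℝ] E := fun q => adjointMap (φ.symm q)⁻¹
  have hsrc : ∀ᶠ q in 𝓝 e, q ∈ φ.target := extChartAt_target_mem_nhds (I := 𝓘(ℝ, E)) (1 : G)
  have hV (η : E) : (fun q => V q η) =ᶠ[𝓝 e] chartField 1 (leftField (G := G) η) := by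
    filter_upwards [hsrc] with q hq
    have h1 := chartField_apply (g₀ := (1 : G)) (g := φ.symm q)
      (by simpa [hφ] using φ.map_target hq) (leftField (G := G) η)
    rw [← hφ, φ.right_inv hq] at h1
    exact h1.symm
  have hY (η : E) : (fun q => Y q η) =ᶠ[𝓝 e] chartField 1 (rightField (G := G) η) := by
    filter_upwards [hsrc] with q hq
    have h1 := chartField_apply (g₀ := (1 : G)) (g := φ.symm q)
      (by simpa [hφ] using φ.map_target hq) (rightField (G := G) η)
    rw [← hφ, φ.right_inv hq] at h1
    exact h1.symm
  have hL (η : E) := ContMDiff.differentiableAt_chartField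
    ((contMDiff_leftField (G := G) η).of_le (by exact ENat.LEInfty.out)) 1
  have hR (η : E) := ContMDiff.differentiableAt_chartField
    ((contMDiff_rightField (G := G) η).of_le (by exact ENat.LEInfty.out)) 1
  have hVd : DifferentiableAt ℝ V e :=
    differentiableAt_clm_of_apply fun η => (hL η).congr_of_eventuallyEq (hV η)
  have hYd : DifferentiableAt ℝ Y e :=
    differentiableAt_clm_of_apply fun η => (hR η).congr_of_eventuallyEq (hY η)
  -- In the chart, `d(L_g) ∘ Ad_{g⁻¹} = d(R_g)`. The factors `V` and `Y` are built from invariant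
  -- fields, and `V` is invertible near the identity, so `A` is differentiable, and its derivative
  -- follows from the product rule.
  have hVA : ∀ q, V q * A q = Y q := by
    intro q
    change ((chartDeriv 1 (φ.symm q)).comp (leftDeriv (φ.symm q))).comp _ = _
    rw [ContinuousLinearMap.comp_assoc, leftDeriv_comp_adjointMap]
  have hc1 : chartDeriv (E := E) (1 : G) 1 = ContinuousLinearMap.id ℝ E := by
    have : IsManifold 𝓘(ℝ, E) 1 G := inferInstance
    exact mfderiv_extChartAt_self
  have hl1 : leftDeriv (E := E) (1 : G) = ContinuousLinearMap.id ℝ E := by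
    simp only [leftDeriv, one_mul, modelDeriv_id]
  have hr1 : rightDeriv (E := E) (1 : G) = ContinuousLinearMap.id ℝ E := by
    simp only [rightDeriv, mul_one, modelDeriv_id]
  have hVe : V e = 1 := by
    simp only [V, he1, hc1, hl1]; rfl
  have hYe : Y e = 1 := by
    simp only [Y, he1, hc1, hr1]; rfl
  have hAe : A e = 1 := by
    have := hVA e
    rwa [hVe, hYe, one_mul] at this
  have hunit : IsUnit (V e) := by rw [hVe]; exact isUnit_one
  have hAeq : A =ᶠ[𝓝 e] fun q => Ring.inverse (V q) * Y q := by
    filter_upwards [hVd.continuousAt.eventually (Units.isOpen.mem_nhds hunit)] with q hq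
    rw [← hVA q, ← mul_assoc, Ring.inverse_mul_cancel _ hq, one_mul]
  have hAd : DifferentiableAt ℝ A e := by
    refine DifferentiableAt.congr_of_eventuallyEq ?_ hAeq
    exact ((differentiableAt_inverse (𝕜 := ℝ) hunit).comp e hVd).mul hYd
  refine ⟨fderiv ℝ A e, fun ζ ξ => ?_, hAd.hasFDerivAt⟩
  have hprod := (hVd.hasFDerivAt.clm_comp hAd.hasFDerivAt)
  have hprod' : HasFDerivAt Y _ e := hprod.congr_of_eventuallyEq
    (Eventually.of_forall fun q => (hVA q).symm)
  have h1 := DFunLike.congr_fun (DFunLike.congr_fun (hprod'.unique hYd.hasFDerivAt) ζ) ξ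
  have hVe' : V e = ContinuousLinearMap.id ℝ E := hVe
  have hAe' : A e = ContinuousLinearMap.id ℝ E := hAe
  simp [hVe', hAe'] at h1
  have dV (η v : E) : fderiv ℝ V e v η = fderiv ℝ (chartField 1 (leftField (G := G) η)) e v := by
    have := hVd.hasFDerivAt.clm_apply (hasFDerivAt_const η e)
    rw [← (hV η).fderiv_eq, this.fderiv]
    simp
  have dY (η v : E) : fderiv ℝ Y e v η = fderiv ℝ (chartField 1 (rightField (G := G) η)) e v := by
    have := hYd.hasFDerivAt.clm_apply (hasFDerivAt_const η e)
    rw [← (hY η).fderiv_eq, this.fderiv]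
    simp
  have vL (η : E) : chartField 1 (leftField (G := G) η) e = η := by
    rw [← (hV η).self_of_nhds]; simp only [hVe']; rfl
  have vR (η : E) : chartField 1 (rightField (G := G) η) e = η := by
    rw [← (hY η).self_of_nhds]; simp only [hYe]; rfl
  -- The product rule leaves `A' ζ ξ = DR_ξ(ζ) - DL_ξ(ζ)`. Commutation of left and right fields
  -- replaces the first term by `DL_ζ(ξ)`, giving the bracket of `L_ξ` and `L_ζ`.
  have hcomm := fderiv_chartField_comm (1 : G) ζ ξ
  rw [← hφ, ← he, vL, vR] at hcomm
  have hb : algBracket G ξ ζ = lieBracket ℝ (chartField 1 (leftField (G := G) ξ))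
      (chartField 1 (leftField (G := G) ζ)) e := mlieBracket_eq_chartField _ _ _
  rw [hb, lieBracket, vL, vL, ← hcomm, ← dY, ← dV, ← h1]
  abel

variable (G) in
/-- The Lie-Poisson tensor at `μ`, as the linear map `ζ ↦ μ [ζ, ·]`. -/
def coadjointForm (μ : E →L[ℝ] ℝ) : E →ₗ[ℝ] (E →L[ℝ] ℝ) :=
  ((ContinuousLinearMap.compL ℝ E E ℝ μ).comp (algBracketCLM G)).toLinearMap

theorem coadjointForm_apply (μ : E →L[ℝ] ℝ) (ζ ξ : E) :
    coadjointForm G μ ζ ξ = μ (algBracket G ζ ξ) := rfl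

/-- The orbit map has derivative `ζ ↦ μ([·, ζ])` at the identity, which is minus the Lie–Poisson
tensor; the sign does not affect the rank. -/
theorem coadjointOrbitDim_eq (μ : E →L[ℝ] ℝ) :
    coadjointOrbitDim G μ = Module.finrank ℝ (LinearMap.range (coadjointForm G μ)) := by
  have : CompleteSpace E := FiniteDimensional.complete ℝ E
  have : IsManifold 𝓘(ℝ, E) 1 G := inferInstance
  obtain ⟨A', hA', hA⟩ := exists_hasFDerivAt_adjointMap (E := E) (G := G)
  have h1 : HasFDerivAt (fun q => coadjointMap ((extChartAt 𝓘(ℝ, E) (1 : G)).symm q) μ)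
      ((ContinuousLinearMap.compL ℝ E E ℝ μ).comp A') (extChartAt 𝓘(ℝ, E) (1 : G) 1) :=
    (ContinuousLinearMap.compL ℝ E E ℝ μ).hasFDerivAt.comp _ hA
  have h2 := h1.hasMFDerivAt.comp (1 : G)
    (mdifferentiableAt_extChartAt (I := 𝓘(ℝ, E)) (mem_chart_source E (1 : G))).hasMFDerivAt
  rw [mfderiv_extChartAt_self] at h2
  have h3 : HasMFDerivAt 𝓘(ℝ, E) 𝓘(ℝ, E →L[ℝ] ℝ) (fun g : G => coadjointMap g μ) 1
      ((ContinuousLinearMap.compL ℝ E E ℝ μ).comp A') := by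
    refine HasMFDerivAt.congr_of_eventuallyEq (f' := _) h2 ?_
    filter_upwards [extChartAt_source_mem_nhds (I := 𝓘(ℝ, E)) (1 : G)] with g hg
    simp only [Function.comp_apply]
    rw [(extChartAt 𝓘(ℝ, E) (1 : G)).left_inv hg]
  rw [coadjointOrbitDim, h3.mfderiv]
  have h4 : ((ContinuousLinearMap.compL ℝ E E ℝ μ).comp A').toLinearMap = -coadjointForm G μ := by
    ext ζ ξ
    change μ (A' ζ ξ) = -μ (algBracket G ζ ξ)
    rw [hA', ← map_neg, algBracket_skew]
  refine Eq.trans (congrArg (fun f : E →ₗ[ℝ] (E →L[ℝ] ℝ) =>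
    Module.finrank ℝ (LinearMap.range f)) h4) ?_
  exact congrArg (fun S : Submodule ℝ (E →L[ℝ] ℝ) => Module.finrank ℝ S)
    (LinearMap.range_neg (coadjointForm G μ))

end CoadjointOrbits
end

/-! ### Local Casimirs, by straightening coadjoint flows. -/

noncomputable section

section LocalInvariants

open Filter Topology NormedSpace

theorem exp_neg_smul_mul_exp_smul {𝔸 : Type*} [NormedRing 𝔸] [NormedAlgebra ℝ 𝔸] [CompleteSpace 𝔸]
    (a : 𝔸) (t : ℝ) : exp (t • -a) * exp (t • a) = 1 := by
  let _ : NormedAlgebra ℚ 𝔸 := NormedAlgebra.restrictScalars ℚ ℝ 𝔸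
  rw [← exp_add_of_commute (by
    rw [smul_neg]; exact (Commute.refl _).neg_left), ← smul_add, neg_add_cancel, smul_zero, exp_zero]

theorem contDiff_exp_smul {𝔸 : Type*} [NormedRing 𝔸] [NormedAlgebra ℝ 𝔸] [CompleteSpace 𝔸]
    (a : 𝔸) : ContDiff ℝ ∞ (fun t : ℝ => exp (t • a)) := by
  have h : ContDiff ℝ ∞ (exp : 𝔸 → 𝔸) := by
    rw [contDiff_iff_contDiffAt]
    intro x
    exact (exp_analytic (𝕂 := ℝ) x).contDiffAt
  exact h.comp (contDiff_id.smul contDiff_const)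

/-- A solution of `y' = a y` in a Banach algebra is `exp (t a) y₀`. -/
theorem eq_exp_smul_mul_of_hasDerivAt {𝔸 : Type*} [NormedRing 𝔸] [NormedAlgebra ℝ 𝔸]
    [CompleteSpace 𝔸] {a : 𝔸} {y : ℝ → 𝔸} (hy : ∀ t, HasDerivAt y (a * y t) t) (t : ℝ) :
    y t = exp (t • a) * y 0 := by
  have h : ∀ t, HasDerivAt (fun t : ℝ => exp (t • -a) * y t) 0 t := by
    intro t
    refine ((hasDerivAt_exp_smul_const (𝕂 := ℝ) (-a) t).fun_mul (hy t)).congr_deriv ?_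
    noncomm_ring
  have hc := is_const_of_deriv_eq_zero (fun t => (h t).differentiableAt)
    (fun t => (h t).deriv) t 0
  simp only [zero_smul, exp_zero, one_mul] at hc
  rw [← hc, ← mul_assoc]
  have := exp_neg_smul_mul_exp_smul (-a) t
  rw [neg_neg] at this
  rw [this, one_mul]


/-- Conjugation by the flow of `L ξ` permutes the linear vector fields `L w` of a
representation. -/
theorem exists_conj_exp_smul {E F : Type*} [NormedAddCommGroup E] [NormedSpace ℝ E]
    [CompleteSpace E] [NormedAddCommGroup F] [NormedSpace ℝ F] [CompleteSpace F]
    (L : E →L[ℝ] F →L[ℝ] F) (D : E →L[ℝ] E) (ξ : E)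
    (hL : ∀ w, L ξ * L w = L w * L ξ + L (D w)) (w : E) (t : ℝ) :
    ∃ w', ∀ ρ, exp (t • L ξ) (L w ρ) = L w' (exp (t • L ξ) ρ) := by
  have hy : ∀ t : ℝ, HasDerivAt (fun t : ℝ => L (exp (t • D) w) * exp (t • L ξ))
      (L ξ * (L (exp (t • D) w) * exp (t • L ξ))) t := by
    intro t
    have h1 : HasDerivAt (fun t : ℝ => exp (t • D) w) (D (exp (t • D) w)) t :=
      ((ContinuousLinearMap.apply ℝ E w).hasFDerivAt).comp_hasDerivAt t
        (hasDerivAt_exp_smul_const' (𝕂 := ℝ) D t)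
    have h2 : HasDerivAt (fun t : ℝ => L (exp (t • D) w)) (L (D (exp (t • D) w))) t :=
      L.hasFDerivAt.comp_hasDerivAt t h1
    refine (h2.fun_mul (hasDerivAt_exp_smul_const' (𝕂 := ℝ) (L ξ) t)).congr_deriv ?_
    rw [← mul_assoc (L ξ), hL]
    noncomm_ring
  have h := eq_exp_smul_mul_of_hasDerivAt hy t
  simp only [zero_smul, exp_zero, mul_one] at h
  exact ⟨exp (t • D) w, fun ρ => (DFunLike.congr_fun h ρ).symm⟩

/-- A chart that straightens the linear vector field `L₁`, and `L₂` along a transversal of the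
flow of `L₁`. -/
theorem exists_chart_straightening_pair {F : Type*} [NormedAddCommGroup F] [NormedSpace ℝ F]
    [CompleteSpace F] (L₁ L₂ : F →L[ℝ] F) (μ : F) (t s : F →L[ℝ] ℝ) (t1 : t (L₁ μ) = 1)
    (t2 : t (L₂ μ) = 0) (s1 : s (L₁ μ) = 0) (s2 : s (L₂ μ) = 1) :
    ∃ (U : Set F) (Ψ : F → F), IsOpen U ∧ μ ∈ U ∧ ContDiffOn ℝ ∞ Ψ U ∧ ∀ ν ∈ U,
      Function.Surjective (fderiv ℝ Ψ ν) ∧ fderiv ℝ Ψ ν (L₁ ν) = L₁ μ ∧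
      ∃ (τ : ℝ) (ρ : F), exp (τ • L₁) ρ = ν ∧ fderiv ℝ Ψ ν (exp (τ • L₁) (L₂ ρ)) = L₂ μ := by
  let c : F →L[ℝ] F := ContinuousLinearMap.id ℝ _ - t.smulRight (L₁ μ) - s.smulRight (L₂ μ)
  have c1 : c (L₁ μ) = 0 := by
    simp [c, t1, s1]
  have c2 : c (L₂ μ) = 0 := by
    simp [c, t2, s2]
  -- Flow by `L₂` for time `s`, then by `L₁` for time `t`, from the transversal `μ + c δ`. Since `c`
  -- removes the two flow directions, the derivative at `0` is `t • L₁ μ + s • L₂ μ + c`, the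
  -- identity. The chart is the local inverse of `Φ`.
  let Φ : F → F := fun δ => exp (t δ • L₁) (exp (s δ • L₂) (μ + c δ))
  have hΦ : ContDiff ℝ ∞ Φ :=
    ((contDiff_exp_smul L₁).comp (g := fun τ : ℝ => exp (τ • L₁)) t.contDiff).clm_apply
      (((contDiff_exp_smul L₂).comp (g := fun τ : ℝ => exp (τ • L₂)) s.contDiff).clm_apply
        (contDiff_const.add c.contDiff))
  have hderiv : ∀ δ, HasFDerivAt Φ
      (t.smulRight (L₁ (Φ δ)) + (exp (t δ • L₁)).comp (s.smulRight
          (L₂ (exp (s δ • L₂) (μ + c δ))) + (exp (s δ • L₂)).comp c)) δ := by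
    intro δ
    have e1 := (hasDerivAt_exp_smul_const' (𝕂 := ℝ) L₁ (t δ)).hasFDerivAt.comp δ t.hasFDerivAt
    have e2 := (hasDerivAt_exp_smul_const' (𝕂 := ℝ) L₂ (s δ)).hasFDerivAt.comp δ s.hasFDerivAt
    have e3 := e1.clm_apply (e2.clm_apply (c.hasFDerivAt.const_add μ))
    refine e3.congr_fderiv ?_
    ext v
    simp [Φ]
    abel
  have hderiv0 : HasFDerivAt Φ ((ContinuousLinearEquiv.refl ℝ F : F →L[ℝ] F)) 0 := by
    refine (hderiv 0).congr_fderiv ?_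
    ext v
    simp [Φ, c]
  have hΦ0 : Φ 0 = μ := by simp [Φ]
  let P := hΦ.contDiffAt.toOpenPartialHomeomorph Φ hderiv0 (by simp)
  have hP0 : (0 : F) ∈ P.source :=
    hΦ.contDiffAt.mem_toOpenPartialHomeomorph_source hderiv0 (by simp)
  have hPμ : μ ∈ P.target := by
    rw [← hΦ0]; exact P.map_source hP0
  have hPsymm : P.symm μ = 0 := by
    rw [← hΦ0]; exact P.left_inv hP0
  let O : Set F := {δ | IsUnit (fderiv ℝ Φ δ)}
  have hO : IsOpen O := Units.isOpen.preimage (hΦ.continuous_fderiv (by simp))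
  let U : Set F := P.target ∩ P.symm ⁻¹' O
  have hU : IsOpen U := P.symm.isOpen_inter_preimage hO
  have hμU : μ ∈ U := by
    refine ⟨hPμ, ?_⟩
    change IsUnit (fderiv ℝ Φ (P.symm μ))
    rw [hPsymm, hderiv0.fderiv]
    exact isUnit_one
  have hsymm : ∀ ν ∈ U, ContDiffAt ℝ ∞ P.symm ν := by
    rintro ν ⟨h1, u, hu⟩
    refine P.contDiffAt_symm (f₀' := ContinuousLinearEquiv.unitsEquiv ℝ _ u) h1 ?_ hΦ.contDiffAt
    have h3 : HasFDerivAt Φ (fderiv ℝ Φ (P.symm ν)) (P.symm ν) :=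
      (hΦ.differentiable (by simp) _).hasFDerivAt
    rw [← hu] at h3
    exact h3
  have hinv : ∀ ν ∈ U, ∀ v, fderiv ℝ P.symm ν (fderiv ℝ Φ (P.symm ν) v) = v := by
    intro ν hν v
    have h1 : HasFDerivAt P.symm (fderiv ℝ P.symm ν) (Φ (P.symm ν)) := by
      have : Φ (P.symm ν) = ν := P.right_inv hν.1
      rw [this]
      exact ((hsymm ν hν).differentiableAt (by simp)).hasFDerivAt
    have h2 := h1.comp (P.symm ν) (hΦ.differentiable (by simp) _).hasFDerivAt
    have h3 : P.symm ∘ Φ =ᶠ[𝓝 (P.symm ν)] id := by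
      filter_upwards [P.open_source.mem_nhds (P.map_target hν.1)] with δ hδ
      exact P.left_inv hδ
    exact DFunLike.congr_fun ((h2.congr_of_eventuallyEq h3.symm).unique (hasFDerivAt_id _)) v
  refine ⟨U, P.symm, hU, hμU, fun ν hν => (hsymm ν hν).contDiffWithinAt, fun ν hν =>
    ⟨fun v => ⟨_, hinv ν hν v⟩, ?_, ?_⟩⟩
  · have h1 : Φ (P.symm ν) = ν := P.right_inv hν.1
    conv_rhs => rw [← hinv ν hν (L₁ μ), (hderiv _).fderiv]
    simp [t1, s1, c1, h1]
  · have h1 : Φ (P.symm ν) = ν := P.right_inv hν.1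
    refine ⟨t (P.symm ν), exp (s (P.symm ν) • L₂) (μ + c (P.symm ν)), h1, ?_⟩
    conv_rhs => rw [← hinv ν hν (L₂ μ), (hderiv _).fderiv]
    simp [t2, s2, c2]

/-- A chart around `μ` that straightens the linear vector field `L ξ`, and at each point some
field `L w`, for a representation `L` of a Lie algebra. -/
theorem exists_chart_straightening {E F : Type*} [NormedAddCommGroup E] [NormedSpace ℝ E]
    [CompleteSpace E] [NormedAddCommGroup F] [NormedSpace ℝ F] [CompleteSpace F]
    (L : E →L[ℝ] F →L[ℝ] F) (D : E →L[ℝ] E) (ξ η : E)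
    (hL : ∀ w ρ, L ξ (L w ρ) = L w (L ξ ρ) + L (D w) ρ) (μ : F) (t s : F →L[ℝ] ℝ)
    (t1 : t (L ξ μ) = 1) (t2 : t (L η μ) = 0) (s1 : s (L ξ μ) = 0) (s2 : s (L η μ) = 1) :
    ∃ (U : Set F) (Ψ : F → F), IsOpen U ∧ μ ∈ U ∧ ContDiffOn ℝ ∞ Ψ U ∧ ∀ ν ∈ U,
      Function.Surjective (fderiv ℝ Ψ ν) ∧ fderiv ℝ Ψ ν (L ξ ν) = L ξ μ ∧
      ∃ w, fderiv ℝ Ψ ν (L w ν) = L η μ := by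
  obtain ⟨U, Ψ, hU, hμU, hΨ, h⟩ := exists_chart_straightening_pair (L ξ) (L η) μ t s t1 t2 s1 s2
  refine ⟨U, Ψ, hU, hμU, hΨ, fun ν hν => ⟨(h ν hν).1, (h ν hν).2.1, ?_⟩⟩
  obtain ⟨τ, ρ, h2, h3⟩ := (h ν hν).2.2
  -- The straightened second vector is `L η` transported along the flow of `L ξ`. Conjugation by
  -- that flow turns it into another field `L w` of the representation, evaluated at `ν` itself.
  obtain ⟨w, hw⟩ := exists_conj_exp_smul L D ξ (fun w => ContinuousLinearMap.ext (hL w)) η τ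
  exact ⟨w, by rw [← h3, hw, h2]⟩

variable {E : Type*} [NormedAddCommGroup E] [NormedSpace ℝ E]

/-- The linear vector field `ν ↦ ν ∘ β w` on `E*`. -/
def coadField (β : E →L[ℝ] E →L[ℝ] E) : E →L[ℝ] (E →L[ℝ] ℝ) →L[ℝ] (E →L[ℝ] ℝ) :=
  (ContinuousLinearMap.compL ℝ E E ℝ).flip.comp β

theorem coadField_apply (β : E →L[ℝ] E →L[ℝ] E) (w : E) (ν : E →L[ℝ] ℝ) (v : E) :
    coadField β w ν v = ν (β w v) := rfl

/-- The Jacobi identity. Precomposition reverses products, so the commutator correction is `β w ξ`,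
not `β ξ w`. -/
theorem coadField_comm {β : E →L[ℝ] E →L[ℝ] E}
    (hj : ∀ a b c, β a (β b c) = β (β a b) c + β b (β a c)) (ξ w : E) (ν : E →L[ℝ] ℝ) :
    coadField β ξ (coadField β w ν) =
      coadField β w (coadField β ξ ν) + coadField β (β w ξ) ν := by
  ext v
  change ν (β w (β ξ v)) = ν (β ξ (β w v)) + ν (β (β w ξ) v)
  rw [hj w ξ v, map_add, add_comm]

/-- The Plücker relation: each of the two-forms `ν ∘ β` is decomposable. -/
def IsDecomposable (β : E →L[ℝ] E →L[ℝ] E) : Prop :=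
  ∀ (ν : E →L[ℝ] ℝ) (a b c d : E),
    ν (β a b) * ν (β c d) - ν (β a c) * ν (β b d) + ν (β a d) * ν (β b c) = 0

/-- The Plücker relation as a statement about Hamiltonian vectors: wherever `ν (β ξ η) ≠ 0`, those
of `ξ` and `η` span all of them. -/
theorem coadField_eq_of_isDecomposable {β : E →L[ℝ] E →L[ℝ] E} (hs : ∀ a b, β a b = -β b a)
    (hp : IsDecomposable β) (ν : E →L[ℝ] ℝ) (ξ η w : E) :
    ν (β ξ η) • coadField β w ν =
      ν (β w η) • coadField β ξ ν - ν (β w ξ) • coadField β η ν := by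
  ext v
  have h := hp ν ξ η w v
  have h1 : ν (β ξ w) = -ν (β w ξ) := by rw [hs, map_neg]
  have h2 : ν (β η w) = -ν (β w η) := by rw [hs, map_neg]
  simp only [coadField_apply, smul_apply, sub_apply,
    smul_eq_mul]
  rw [h1, h2] at h
  linear_combination h


theorem finrank_ker_pair [FiniteDimensional ℝ E] {f g : E →L[ℝ] ℝ} {ξ η : E} (h1 : f ξ = 0)
    (h2 : f η ≠ 0) (h3 : g ξ ≠ 0) (h4 : g η = 0) :
    Module.finrank ℝ (LinearMap.ker (f.prod g).toLinearMap) = Module.finrank ℝ E - 2 := by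
  have hs : Function.Surjective (f.prod g) := by
    rintro ⟨a, b⟩
    refine ⟨(a / f η) • η + (b / g ξ) • ξ, ?_⟩
    ext <;> simp [h1, h4, div_mul_cancel₀ _ h2, div_mul_cancel₀ _ h3]
  have h := LinearMap.finrank_range_add_finrank_ker (f.prod g).toLinearMap
  rw [LinearMap.range_eq_top.2 hs, finrank_top] at h
  -- The range has dimension `2`, so `n ≥ 2` and the natural-number subtraction is not truncated.
  simp only [Module.finrank_prod, Module.finrank_self] at h
  omega

theorem linearIndependent_of_apply {ι F : Type*} [Fintype ι] [NormedAddCommGroup F]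
    [NormedSpace ℝ F] {e : ι → E}
    {φ : ι → F →L[ℝ] ℝ} {A : F → E →L[ℝ] ℝ} (hA : Function.Surjective A)
    (he : LinearIndependent ℝ e) (h : ∀ i δ, φ i δ = A δ (e i)) : LinearIndependent ℝ φ := by
  refine Fintype.linearIndependent_iff.2 fun a ha => ?_
  refine Fintype.linearIndependent_iff.1 he a
    ((SeparatingDual.eq_iff_forall_dual_eq (R := ℝ)).2 fun ρ => ?_)
  obtain ⟨δ, rfl⟩ := hA ρ
  have h1 := DFunLike.congr_fun ha δ
  simp only [sum_apply, smul_apply, h, zero_apply] at h1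
  simpa using h1

/-- Around a point where the form `ν ∘ β` has rank two, a Lie algebra all of whose forms are
decomposable has `n - 2` independent functions that are constant along the coadjoint action. -/
theorem exists_local_invariants [FiniteDimensional ℝ E] {β : E →L[ℝ] E →L[ℝ] E}
    (hs : ∀ a b, β a b = -β b a)
    (hj : ∀ a b c, β a (β b c) = β (β a b) c + β b (β a c)) (hp : IsDecomposable β)
    {μ : E →L[ℝ] ℝ} {ξ η : E} (hμ : μ (β ξ η) ≠ 0) :
    ∃ U : Set (E →L[ℝ] ℝ), IsOpen U ∧ μ ∈ U ∧
      ∃ C : Fin (Module.finrank ℝ E - 2) → (E →L[ℝ] ℝ) → ℝ,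
        (∀ i, ContDiffOn ℝ ∞ (C i) U) ∧
        (∀ ν ∈ U, ∀ i w, fderiv ℝ (C i) ν (coadField β w ν) = 0) ∧
        ∀ ν ∈ U, LinearIndependent ℝ (fun i => fderiv ℝ (C i) ν) := by
  have : CompleteSpace E := FiniteDimensional.complete ℝ E
  have hself : ∀ a, β a a = 0 := fun a => by
    have h := hs a a
    have h2 : (2 : ℝ) • β a a = 0 := by rw [two_smul]; nth_rw 2 [h]; exact add_neg_cancel _
    exact (smul_eq_zero.1 h2).resolve_left two_ne_zero
  have hηξ : μ (β η ξ) = -μ (β ξ η) := by rw [hs, map_neg]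
  let t : (E →L[ℝ] ℝ) →L[ℝ] ℝ := (μ (β ξ η))⁻¹ • ContinuousLinearMap.apply ℝ ℝ η
  let s : (E →L[ℝ] ℝ) →L[ℝ] ℝ := -(μ (β ξ η))⁻¹ • ContinuousLinearMap.apply ℝ ℝ ξ
  have t_apply : ∀ ν, t ν = (μ (β ξ η))⁻¹ * ν η := fun _ => rfl
  have s_apply : ∀ ν, s ν = -(μ (β ξ η))⁻¹ * ν ξ := fun _ => rfl
  have s1 : s (coadField β ξ μ) = 0 := by
    rw [s_apply, coadField_apply, hself, map_zero, mul_zero]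
  have s2 : s (coadField β η μ) = 1 := by
    rw [s_apply, coadField_apply, hηξ, neg_mul_neg, inv_mul_cancel₀ hμ]
  obtain ⟨U, Ψ, hU, hμU, hΨ, hν⟩ := exists_chart_straightening (coadField β) (β.flip ξ) ξ η
    (coadField_comm hj ξ) μ t s
    (by rw [t_apply, coadField_apply, inv_mul_cancel₀ hμ])
    (by rw [t_apply, coadField_apply, hself, map_zero, mul_zero]) s1 s2
  let f : E →L[ℝ] ℝ := coadField β ξ μ
  let g : E →L[ℝ] ℝ := coadField β η μ
  -- The annihilator in `E` of the constant plane spanned by the Hamiltonian vectors of `ξ` and `η`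
  -- at `μ`. A basis `e` of it gives the invariants `ν ↦ Ψ ν (e i)`.
  let K := LinearMap.ker (f.prod g).toLinearMap
  have hK : Module.finrank ℝ K = Module.finrank ℝ E - 2 :=
    finrank_ker_pair (ξ := ξ) (η := η) (by simp [f, coadField_apply, hself])
      (by simpa [f, coadField_apply] using hμ)
      (by simpa [g, coadField_apply, hηξ] using hμ) (by simp [g, coadField_apply, hself])
  let e : Module.Basis (Fin (Module.finrank ℝ E - 2)) ℝ K := Module.finBasisOfFinrankEq ℝ K hK
  have he : ∀ i, coadField β ξ μ (e i) = 0 ∧ coadField β η μ (e i) = 0 := fun i =>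
    Prod.mk.inj (LinearMap.mem_ker.1 (e i).2)
  have hdiff : ∀ ν ∈ U, DifferentiableAt ℝ Ψ ν := fun ν h =>
    (hΨ.contDiffAt (hU.mem_nhds h)).differentiableAt (by simp)
  have hC : ∀ ν ∈ U, ∀ i δ, fderiv ℝ (fun ν' => Ψ ν' (e i)) ν δ = fderiv ℝ Ψ ν δ (e i) := by
    intro ν h i δ
    have := (ContinuousLinearMap.apply ℝ ℝ (e i : E)).hasFDerivAt.comp ν (hdiff ν h).hasFDerivAt
    exact DFunLike.congr_fun this.fderiv δ
  refine ⟨U ∩ {ν | ν (β ξ η) ≠ 0}, hU.inter (isOpen_ne_fun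
    (ContinuousLinearMap.apply ℝ ℝ (β ξ η)).continuous continuous_const), ⟨hμU, hμ⟩,
    fun i ν => Ψ ν (e i), fun i => ?_, ?_, ?_⟩
  · exact ((ContinuousLinearMap.apply ℝ ℝ (e i : E)).contDiff.comp_contDiffOn hΨ).mono
      Set.inter_subset_left
  · rintro ν ⟨hνU, hne⟩ i w
    obtain ⟨-, h1, w', h3⟩ := hν ν hνU
    rw [hC ν hνU]
    set A := fderiv ℝ Ψ ν
    have hw1 : A (coadField β ξ ν) (e i) = 0 := by rw [h1]; exact (he i).1
    have key := fun v => congrArg A (coadField_eq_of_isDecomposable hs hp ν ξ η v)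
    simp only [map_sub, map_smul] at key
    have hw2 : A (coadField β η ν) (e i) = 0 := by
      have h4 := key w'
      rw [h3, h1] at h4
      -- If this coefficient vanished, the straightened vector `L η μ` would have a nonzero multiple
      -- proportional to `L ξ μ`, contradicted by `s`. Dividing by it expresses the image of the
      -- field of `η` through vectors that `e i` annihilates.
      have h5 : ν (β w' ξ) ≠ 0 := by
        intro h0
        have := congrArg s h4
        rw [h0, zero_smul, sub_zero, map_smul, map_smul, s1, s2] at this
        simp at this
        exact hne this
      have h6 := DFunLike.congr_fun h4 (e i : E)
      simp only [smul_apply, sub_apply, smul_eq_mul, (he i).1, (he i).2, mul_zero,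
        zero_sub] at h6
      simpa [h5] using h6
    have h7 := DFunLike.congr_fun (key w) (e i : E)
    simp only [smul_apply, sub_apply, smul_eq_mul, hw1, hw2, mul_zero, sub_zero] at h7
    exact (mul_eq_zero.1 h7).resolve_left hne
  · rintro ν ⟨hνU, -⟩
    exact linearIndependent_of_apply (hν ν hνU).1
      (e.linearIndependent.map' K.subtype K.ker_subtype) (hC ν hνU)

end LocalInvariants
end

/-! ### Structure of Lie algebras all of whose forms `ν ∘ β` are decomposable. -/

noncomputable section

section DecomposableBrackets

variable {E : Type*} [NormedAddCommGroup E] [NormedSpace ℝ E]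

theorem exists_relation_of_finrank_range_le {V W : Type*} [AddCommGroup V] [Module ℝ V]
    [AddCommGroup W] [Module ℝ W] [FiniteDimensional ℝ W] {f : V →ₗ[ℝ] W}
    (hf : Module.finrank ℝ (LinearMap.range f) ≤ 2) (a b c : V) :
    ∃ x y z : ℝ, ¬ (x = 0 ∧ y = 0 ∧ z = 0) ∧ x • f a + y • f b + z • f c = 0 := by
  have hdep : ¬ LinearIndependent ℝ ![f.rangeRestrict a, f.rangeRestrict b,
      f.rangeRestrict c] := by
    intro hli
    have := hli.fintype_card_le_finrank
    simp only [Fintype.card_fin] at this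
    omega
  obtain ⟨g, hg, i, hi⟩ := Fintype.not_linearIndependent_iff.1 hdep
  refine ⟨g 0, g 1, g 2, fun h => ?_, ?_⟩
  · fin_cases i <;> simp_all
  · have := congrArg Subtype.val hg
    simpa [Fin.sum_univ_three] using this

/-- A skew form of rank at most two satisfies the Plücker relation. -/
theorem pluecker_of_finrank_range_le [FiniteDimensional ℝ E] {B : E →ₗ[ℝ] E →L[ℝ] ℝ}
    (hs : ∀ a b, B a b = -B b a) (hB : Module.finrank ℝ (LinearMap.range B) ≤ 2) (a b c d : E) :
    B a b * B c d - B a c * B b d + B a d * B b c = 0 := by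
  have hself : ∀ a, B a a = 0 := fun a => by linarith [hs a a]
  -- Rank at most two makes `B a`, `B b`, `B c` dependent. When `B a b ≠ 0` the coefficient `z` of
  -- `B c` cannot vanish, and evaluating the relation at `a`, `b` and `d` gives `z` times the claim.
  have key : ∀ a b c d, B a b ≠ 0 → B a b * B c d - B a c * B b d + B a d * B b c = 0 := by
    intro a b c d hab
    obtain ⟨x, y, z, hxyz, hg⟩ := exists_relation_of_finrank_range_le hB a b c
    have hg' : ∀ v, x * B a v + y * B b v + z * B c v = 0 := fun v => DFunLike.congr_fun hg v
    have ha := hg' a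
    have hb := hg' b
    rw [hself, hs b a] at ha
    rw [hself] at hb
    have hz : z ≠ 0 := by
      intro h2
      have h1 : y = 0 := by simpa [h2, hab] using ha
      have h0 : x = 0 := by simpa [h2, hab] using hb
      exact hxyz ⟨h0, h1, h2⟩
    have hd := hg' d
    have hm : z * (B a b * B c d - B a c * B b d + B a d * B b c) = 0 := by
      rw [hs c b] at hb
      rw [hs c a] at ha
      linear_combination B a b * hd + B b d * ha - B a d * hb
    exact (mul_eq_zero.1 hm).resolve_left hz
  by_cases hab : B a b = 0
  · by_cases hac : B a c = 0
    · by_cases had : B a d = 0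
      · simp [hab, hac, had]
      · have h := key a d b c had
        rw [hab, hac] at h ⊢
        linear_combination h
    · linear_combination -key a c b d hac + B a d * hs b c
  · exact key a b c d hab

theorem isDecomposable_of_dense [FiniteDimensional ℝ E] {β : E →L[ℝ] E →L[ℝ] E}
    (h : Dense {ν : E →L[ℝ] ℝ | ∀ a b c d : E,
      ν (β a b) * ν (β c d) - ν (β a c) * ν (β b d) + ν (β a d) * ν (β b c) = 0}) :
    IsDecomposable β := by
  intro ν a b c d
  have hc : ∀ v : E, Continuous fun ν : E →L[ℝ] ℝ => ν v := fun v =>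
    (ContinuousLinearMap.apply ℝ ℝ v).continuous
  have hcl : IsClosed {ν : E →L[ℝ] ℝ |
      ν (β a b) * ν (β c d) - ν (β a c) * ν (β b d) + ν (β a d) * ν (β b c) = 0} :=
    isClosed_eq ((((hc _).mul (hc _)).sub ((hc _).mul (hc _))).add ((hc _).mul (hc _)))
      continuous_const
  refine closure_minimal ?_ hcl (h ν)
  intro ν hν
  exact hν a b c d

theorem isDecomposable_algBracketCLM [FiniteDimensional ℝ E]
    {G : Type*} [TopologicalSpace G] [ChartedSpace E G] [Group G] [LieGroup 𝓘(ℝ, E) ∞ G]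
    (hgen : Dense {μ : E →L[ℝ] ℝ | coadjointOrbitDim G μ = 2}) :
    IsDecomposable (algBracketCLM (E := E) G) := by
  have : CompleteSpace E := FiniteDimensional.complete ℝ E
  refine isDecomposable_of_dense (hgen.mono fun μ hμ => ?_)
  have hμ' : coadjointOrbitDim G μ = 2 := hμ
  rw [coadjointOrbitDim_eq] at hμ'
  refine pluecker_of_finrank_range_le (B := coadjointForm G μ) (fun a b => ?_) hμ'.le
  rw [coadjointForm_apply, coadjointForm_apply, ← map_neg, algBracket_skew]

theorem IsDecomposable.polar {β : E →L[ℝ] E →L[ℝ] E} (hp : IsDecomposable β)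
    (μ ν : E →L[ℝ] ℝ) (a b c d : E) :
    μ (β a b) * ν (β c d) + ν (β a b) * μ (β c d) - μ (β a c) * ν (β b d) - ν (β a c) * μ (β b d) +
      μ (β a d) * ν (β b c) + ν (β a d) * μ (β b c) = 0 := by
  have h := hp (μ + ν) a b c d
  simp only [add_apply] at h
  linear_combination h - hp μ a b c d - hp ν a b c d

section Skew

variable {β : E →L[ℝ] E →L[ℝ] E} {μ : E →L[ℝ] ℝ} {e₁ e₂ : E}

/-- A decomposable form that is `1` on the pair `e₁, e₂` is nondegenerate on their span, and the
Plücker relation puts the remaining component of `v` in its radical. -/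
theorem exists_eq_add_ker (hs : ∀ a b, β a b = -β b a) (hp : IsDecomposable β)
    (hμ : μ (β e₁ e₂) = 1) (v : E) :
    ∃ (a b : ℝ) (k : E), v = a • e₁ + b • e₂ + k ∧ ∀ u, μ (β k u) = 0 := by
  have hs' : ∀ a b, μ (β a b) = -μ (β b a) := fun a b => by rw [hs, map_neg]
  have h11 : μ (β e₁ e₁) = 0 := by linarith [hs' e₁ e₁]
  have h22 : μ (β e₂ e₂) = 0 := by linarith [hs' e₂ e₂]
  refine ⟨μ (β v e₂), -μ (β v e₁), v - (μ (β v e₂) • e₁ + -μ (β v e₁) • e₂), by abel, fun u => ?_⟩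
  have h1 := hp μ e₁ e₂ v u
  have h2 := hs' e₁ v
  have h3 := hs' e₂ v
  simp only [map_sub, map_add, map_smul, sub_apply, add_apply, smul_apply, smul_eq_mul]
  rw [hμ, h2, h3] at h1
  linear_combination h1

/-- The kernel of each nonzero form `μ ∘ β` is abelian. -/
theorem bracket_eq_zero_of_mem_ker (hs : ∀ a b, β a b = -β b a) (hp : IsDecomposable β)
    (hμ : μ (β e₁ e₂) = 1) {c d : E} (hc : ∀ u, μ (β c u) = 0) (hd : ∀ u, μ (β d u) = 0) :
    β c d = 0 := by
  refine SeparatingDual.eq_zero_of_forall_dual_eq_zero (R := ℝ) fun ν => ?_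
  have h := hp.polar μ ν e₁ e₂ c d
  have h1 : ∀ u, μ (β u c) = 0 := fun u => by rw [hs, map_neg, hc, neg_zero]
  have h2 : ∀ u, μ (β u d) = 0 := fun u => by rw [hs, map_neg, hd, neg_zero]
  simpa [hμ, hc, h1, h2] using h

/-- Since `c` and `d` commute, one Plücker term drops out. Holding for every `ν`, the result is an
equality of products of linear forms on `E*`. -/
theorem mul_comm_of_mem_ker (hs : ∀ a b, β a b = -β b a) (hp : IsDecomposable β)
    (hμ : μ (β e₁ e₂) = 1) {c d : E} (hc : ∀ u, μ (β c u) = 0) (hd : ∀ u, μ (β d u) = 0)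
    (ν : E →L[ℝ] ℝ) : ν (β e₁ c) * ν (β e₂ d) = ν (β e₁ d) * ν (β e₂ c) := by
  have h := hp ν e₁ e₂ c d
  rw [bracket_eq_zero_of_mem_ker hs hp hμ hc hd, map_zero] at h
  linear_combination -h

theorem mul_polar_of_forall {p q r s : E} (h : ∀ ν : E →L[ℝ] ℝ, ν p * ν s = ν r * ν q)
    (ν ρ : E →L[ℝ] ℝ) : ν p * ρ s + ρ p * ν s = ν r * ρ q + ρ r * ν q := by
  have h1 := h (ν + ρ)
  simp only [add_apply] at h1
  linear_combination h1 - h ν - h ρ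

theorem eq_zero_of_forall_mul_eq_zero {p s : E} (hp : p ≠ 0)
    (h : ∀ ν : E →L[ℝ] ℝ, ν p * ν s = 0) : s = 0 := by
  obtain ⟨ρ, hρ⟩ := SeparatingDual.exists_eq_one (R := ℝ) hp
  refine SeparatingDual.eq_zero_of_forall_dual_eq_zero (R := ℝ) fun ν => ?_
  have h1 := mul_polar_of_forall (q := 0) (r := 0) (fun ν => by simpa using h ν) ν ρ
  have h2 := h ρ
  simp only [map_zero, mul_zero, add_zero, hρ, one_mul] at h1 h2
  rw [h2, mul_zero, zero_add] at h1
  exact h1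

/-- Unique factorization in the symmetric algebra of `E`: in `p s = r q` with `p`, `q` independent,
`p` must divide `r`. The proof polarizes and tests on functionals `ν₁`, `ν₂` dual to `p`, `q`. -/
theorem exists_smul_of_forall_mul_eq [FiniteDimensional ℝ E] {p q r s : E} (hp : p ≠ 0)
    (hq : ∀ y : ℝ, y • p ≠ q) (h : ∀ ν : E →L[ℝ] ℝ, ν p * ν s = ν r * ν q) :
    ∃ l : ℝ, r = l • p ∧ s = l • q := by
  have hmem : q ∉ Submodule.span ℝ {p} := fun hmem => by
    obtain ⟨y, hy⟩ := Submodule.mem_span_singleton.1 hmem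
    exact hq y hy
  obtain ⟨f, hfq, hf⟩ := Submodule.exists_le_ker_of_notMem hmem
  have hfp : f p = 0 := hf (Submodule.mem_span_singleton_self p)
  let ν₂ : E →L[ℝ] ℝ := (f q)⁻¹ • LinearMap.toContinuousLinearMap f
  have h2p : ν₂ p = 0 := by simp [ν₂, hfp]
  have h2q : ν₂ q = 1 := by simp [ν₂, hfq]
  obtain ⟨ρ, hρ⟩ := SeparatingDual.exists_eq_one (R := ℝ) hp
  let ν₁ : E →L[ℝ] ℝ := ρ - ρ q • ν₂
  have h1p : ν₁ p = 1 := by simp [ν₁, hρ, h2p]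
  have h1q : ν₁ q = 0 := by simp [ν₁, h2q]
  have hpol := mul_polar_of_forall h
  have h1s : ν₁ s = 0 := by simpa [h1p, h1q] using h ν₁
  have h2r : ν₂ r = 0 := by simpa [h2p, h2q] using (h ν₂).symm
  have hrs : ν₁ r = ν₂ s := by
    have := hpol ν₁ ν₂
    simp only [h1p, h2p, h1q, h2q] at this
    linarith
  refine ⟨ν₁ r, ?_, ?_⟩ <;>
  refine (SeparatingDual.eq_iff_forall_dual_eq (R := ℝ)).2 fun ν => ?_
  · have := hpol ν₂ ν
    simp only [h2p, h2q, h2r] at this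
    rw [map_smul, hrs, smul_eq_mul]
    linarith
  · have := hpol ν₁ ν
    simp only [h1p, h1q, h1s] at this
    rw [map_smul, smul_eq_mul]
    linarith

/-- The span of a commuting set is abelian. One extra vector fills `E`, so its codimension is at
most one, and it is not zero because `β` is nonzero. -/
theorem finrank_span_of_commuting [FiniteDimensional ℝ E] {S : Set E}
    (hS : ∀ a ∈ S, ∀ b ∈ S, β a b = 0) {e : E} (he : ∀ w, ∃ c : ℝ, w - c • e ∈ Submodule.span ℝ S)
    (hβ : ∃ a b, β a b ≠ 0) :
    ∃ V : Submodule ℝ E, Module.finrank ℝ V + 1 = Module.finrank ℝ E ∧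
      ∀ a ∈ V, ∀ b ∈ V, β a b = 0 := by
  have hab : ∀ a ∈ Submodule.span ℝ S, ∀ b ∈ Submodule.span ℝ S, β a b = 0 := by
    have h1 : ∀ a ∈ S, Submodule.span ℝ S ≤ LinearMap.ker (β a).toLinearMap := fun a ha =>
      Submodule.span_le.2 fun b hb => hS a ha b hb
    intro a ha b hb
    have h2 : Submodule.span ℝ S ≤ LinearMap.ker (β.flip b).toLinearMap :=
      Submodule.span_le.2 fun a ha => h1 a ha hb
    exact h2 ha
  refine ⟨Submodule.span ℝ S, ?_, hab⟩
  have htop : Submodule.span ℝ S ⊔ Submodule.span ℝ {e} = ⊤ := by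
    refine eq_top_iff.2 fun w _ => ?_
    obtain ⟨c, hc⟩ := he w
    exact Submodule.mem_sup.2 ⟨_, hc, c • e, Submodule.mem_span_singleton.2 ⟨c, rfl⟩, by abel⟩
  have h1 := Submodule.finrank_add_le_finrank_add_finrank (Submodule.span ℝ S)
    (Submodule.span ℝ {e})
  rw [htop, finrank_top] at h1
  have h2 := finrank_span_le_card (R := ℝ) ({e} : Set E)
  simp only [Set.toFinset_singleton, Finset.card_singleton] at h2
  have h3 : Module.finrank ℝ (Submodule.span ℝ S) < Module.finrank ℝ E := by
    refine Submodule.finrank_lt fun h => ?_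
    obtain ⟨a, b, hne⟩ := hβ
    exact hne (hab a (h ▸ Submodule.mem_top) b (h ▸ Submodule.mem_top))
  omega

theorem exists_abelian_hyperplane_of_centralizes_ker [FiniteDimensional ℝ E]
    (hs : ∀ a b, β a b = -β b a) (hp : IsDecomposable β) (hμ : μ (β e₁ e₂) = 1)
    (h : ∀ k, (∀ u, μ (β k u) = 0) → β e₁ k = 0) :
    ∃ V : Submodule ℝ E, Module.finrank ℝ V + 1 = Module.finrank ℝ E ∧
      ∀ a ∈ V, ∀ b ∈ V, β a b = 0 := by
  have h11 : β e₁ e₁ = 0 := by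
    have h2 : (2 : ℝ) • β e₁ e₁ = 0 := by
      rw [two_smul]; nth_rw 2 [hs]; exact add_neg_cancel _
    exact (smul_eq_zero.1 h2).resolve_left two_ne_zero
  refine finrank_span_of_commuting (β := β) (S := insert e₁ {k | ∀ u, μ (β k u) = 0}) ?_
    (e := e₂) ?_ ⟨e₁, e₂, fun h0 => by simp [h0] at hμ⟩
  · rintro a (rfl | ha) b (rfl | hb)
    · exact h11
    · exact h b hb
    · rw [hs, h a ha, neg_zero]
    · exact bracket_eq_zero_of_mem_ker hs hp hμ ha hb
  · intro w
    obtain ⟨a, b, k, rfl, hk⟩ := exists_eq_add_ker hs hp hμ w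
    refine ⟨b, ?_⟩
    have : a • e₁ + b • e₂ + k - b • e₂ = a • e₁ + k := by abel
    rw [this]
    exact add_mem (Submodule.smul_mem _ _ (Submodule.subset_span (Set.mem_insert _ _)))
      (Submodule.subset_span (Set.mem_insert_of_mem _ hk))

/-- A Lie algebra all of whose forms are decomposable has an abelian hyperplane, or is a central
extension of a three-dimensional algebra with independent brackets. -/
theorem exists_abelian_hyperplane_or [FiniteDimensional ℝ E]
    (hs : ∀ a b, β a b = -β b a) (hp : IsDecomposable β) (hβ : ∃ a b, β a b ≠ 0) :
    (∃ V : Submodule ℝ E, Module.finrank ℝ V + 1 = Module.finrank ℝ E ∧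
      ∀ a ∈ V, ∀ b ∈ V, β a b = 0) ∨
    ∃ e₁ e₂ e₃ : E, (∀ v, ∃ (a b c : ℝ) (z : E),
        v = a • e₁ + b • e₂ + c • e₃ + z ∧ ∀ u, β z u = 0) ∧
      ∀ a b c : ℝ, a • β e₂ e₃ + b • β e₃ e₁ + c • β e₁ e₂ = 0 → a = 0 ∧ b = 0 ∧ c = 0 := by
  obtain ⟨e₁, e₂, hne⟩ := hβ
  obtain ⟨μ, hμ⟩ := SeparatingDual.exists_eq_one (R := ℝ) hne
  -- The cases compare `ad e₁` and `ad e₂` on the radical of `μ ∘ β`, itself abelian of codimension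
  -- two. If `e₁` centralizes it, adjoining `e₁` gives the hyperplane. Otherwise the question is
  -- whether the two maps ever take independent values on one `k`.
  by_cases hA : ∀ k, (∀ u, μ (β k u) = 0) → β e₁ k = 0
  · exact Or.inl (exists_abelian_hyperplane_of_centralizes_ker hs hp hμ hA)
  by_cases hB : ∃ k, (∀ u, μ (β k u) = 0) ∧ β e₁ k ≠ 0 ∧ ∀ y : ℝ, y • β e₁ k ≠ β e₂ k
  · obtain ⟨e₃, h3, hne3, hind⟩ := hB
    have hself : ∀ a, β a a = 0 := fun a => by
      have h2 : (2 : ℝ) • β a a = 0 := by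
        rw [two_smul]; nth_rw 2 [hs]; exact add_neg_cancel _
      exact (smul_eq_zero.1 h2).resolve_left two_ne_zero
    have hdec : ∀ v, ∃ (a b c : ℝ) (z : E),
        v = a • e₁ + b • e₂ + c • e₃ + z ∧ ∀ u, β z u = 0 := by
      intro v
      obtain ⟨a, b, k, rfl, hk⟩ := exists_eq_add_ker hs hp hμ v
      obtain ⟨l, hl1, hl2⟩ := exists_smul_of_forall_mul_eq hne3 hind
        (mul_comm_of_mem_ker hs hp hμ h3 hk)
      refine ⟨a, b, l, k - l • e₃, by abel, fun u => ?_⟩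
      obtain ⟨a', b', k', rfl, hk'⟩ := exists_eq_add_ker hs hp hμ u
      have e1 : β k e₁ = l • β e₃ e₁ := by rw [hs, hl1, hs e₃, smul_neg]
      have e2 : β k e₂ = l • β e₃ e₂ := by rw [hs, hl2, hs e₃, smul_neg]
      simp only [map_sub, map_add, map_smul, sub_apply, smul_apply, e1, e2,
        bracket_eq_zero_of_mem_ker hs hp hμ hk hk', bracket_eq_zero_of_mem_ker hs hp hμ h3 hk']
      module
    -- With this relation `e₁ + x e₃` and `e₂ + y e₃` commute, and together with the centre they
    -- span a hyperplane. Without it the three brackets are independent.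
    by_cases hC : ∃ x y : ℝ, β e₁ e₂ = x • β e₂ e₃ + y • β e₃ e₁
    · left
      obtain ⟨x, y, hxy⟩ := hC
      have huv : β (e₁ + x • e₃) (e₂ + y • e₃) = 0 := by
        simp only [map_add, map_smul, add_apply, smul_apply, hxy, hself, hs e₃ e₂, hs e₃ e₁]
        module
      refine finrank_span_of_commuting (β := β)
        (S := {e₁ + x • e₃, e₂ + y • e₃} ∪ {z | ∀ u, β z u = 0}) ?_ (e := e₃) ?_ ⟨e₁, e₂, hne⟩
      · rintro a ((rfl | rfl) | ha) b hb
        · rcases hb with (rfl | rfl) | hb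
          · exact hself _
          · exact huv
          · rw [hs, hb, neg_zero]
        · rcases hb with (rfl | rfl) | hb
          · rw [hs, huv, neg_zero]
          · exact hself _
          · rw [hs, hb, neg_zero]
        · exact ha b
      · intro w
        obtain ⟨a, b, c, z, rfl, hz⟩ := hdec w
        refine ⟨c - a * x - b * y, ?_⟩
        have : a • e₁ + b • e₂ + c • e₃ + z - (c - a * x - b * y) • e₃ =
            a • (e₁ + x • e₃) + b • (e₂ + y • e₃) + z := by module
        rw [this]
        refine add_mem (add_mem (Submodule.smul_mem _ _ (Submodule.subset_span ?_))
          (Submodule.smul_mem _ _ (Submodule.subset_span ?_))) (Submodule.subset_span ?_)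
        · exact Or.inl (Or.inl rfl)
        · exact Or.inl (Or.inr rfl)
        · exact Or.inr hz
    · right
      refine ⟨e₁, e₂, e₃, hdec, fun a b c h => ?_⟩
      have hc : c = 0 := by
        by_contra hc
        refine hC ⟨-(c⁻¹ * a), -(c⁻¹ * b), ?_⟩
        have h1 := congrArg (fun v => c⁻¹ • v) h
        simp only [smul_add, smul_smul, inv_mul_cancel₀ hc, one_smul, smul_zero] at h1
        rw [← sub_eq_zero, ← h1]
        module
      rw [hc, zero_smul, add_zero] at h
      have ha : a = 0 := by
        by_contra ha
        refine hind (a⁻¹ * b) ?_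
        have h1 := congrArg (fun v => a⁻¹ • v) h
        simp only [smul_add, smul_smul, inv_mul_cancel₀ ha, one_smul, smul_zero] at h1
        rw [hs e₃ e₁] at h1
        rw [← sub_eq_zero, ← neg_eq_zero, ← h1]
        module
      rw [ha, zero_smul, zero_add, hs e₃ e₁, smul_neg, neg_eq_zero] at h
      exact ⟨ha, (smul_eq_zero.1 h).resolve_right hne3, hc⟩
  · left
    push Not at hA hB
    obtain ⟨c, hc, hc1⟩ := hA
    obtain ⟨y, hy⟩ := hB c hc hc1
    -- Here `[e₂, c] = y [e₁, c]` with `[e₁, c] ≠ 0`. Cancelling the factor `[e₁, c]` from the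
    -- product identity shows that `e₂ - y e₁` centralizes the radical; pairing it with `-e₁` keeps
    -- the value of `μ ∘ β` at `1`.
    refine exists_abelian_hyperplane_of_centralizes_ker (μ := μ) (e₁ := e₂ - y • e₁) (e₂ := -e₁)
      hs hp ?_ fun k hk => ?_
    · have h1 : μ (β e₁ e₁) = 0 := by
        have : μ (β e₁ e₁) = -μ (β e₁ e₁) := by rw [← map_neg, ← hs]
        linarith
      have h2 : μ (β e₂ e₁) = -1 := by rw [hs, map_neg, hμ]
      simp [h1, h2]
    · refine eq_zero_of_forall_mul_eq_zero hc1 fun ν => ?_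
      have h := mul_comm_of_mem_ker hs hp hμ hc hk ν
      rw [← hy] at h
      simp only [map_sub, map_smul, sub_apply, smul_apply, smul_eq_mul] at h ⊢
      linear_combination h

end Skew

end DecomposableBrackets
end

/-! ### Families of `n - 1` functions in involution on `𝔤*`. -/

noncomputable section

section CommutingFamilies

variable {E : Type*} [NormedAddCommGroup E] [NormedSpace ℝ E]

theorem dense_apply_ne_zero {v : E} (hv : v ≠ 0) : Dense {μ : E →L[ℝ] ℝ | μ v ≠ 0} := by
  have h : {μ : E →L[ℝ] ℝ | μ v ≠ 0} =
      ((LinearMap.ker (ContinuousLinearMap.apply ℝ ℝ v).toLinearMap :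
        Submodule ℝ (E →L[ℝ] ℝ)) : Set (E →L[ℝ] ℝ))ᶜ := rfl
  rw [h, ← interior_eq_empty_iff_dense_compl, ← Set.not_nonempty_iff_eq_empty]
  intro hne
  obtain ⟨μ, hμ⟩ := SeparatingDual.exists_eq_one (R := ℝ) hv
  have h1 : μ ∈ LinearMap.ker (ContinuousLinearMap.apply ℝ ℝ v).toLinearMap := by
    rw [Submodule.eq_top_of_nonempty_interior' _ hne]
    exact Submodule.mem_top
  have h2 : μ v = 0 := h1
  rw [hμ] at h2
  exact one_ne_zero h2

theorem bidualVector_eq_of_apply [FiniteDimensional ℝ E] {φ : (E →L[ℝ] ℝ) →L[ℝ] ℝ} {w : E}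
    (h : ∀ μ : E →L[ℝ] ℝ, φ μ = μ w) : bidualVector φ = w :=
  (SeparatingDual.eq_iff_forall_dual_eq (R := ℝ)).2 fun μ => (apply_bidualVector φ μ).trans (h μ)

theorem bidualVector_fderiv_apply [FiniteDimensional ℝ E] (w : E) (μ : E →L[ℝ] ℝ) :
    bidualVector (fderiv ℝ (fun ν : E →L[ℝ] ℝ => ν w) μ) = w := by
  have h : HasFDerivAt (fun ν : E →L[ℝ] ℝ => ν w) (ContinuousLinearMap.apply ℝ ℝ w) μ :=
    (ContinuousLinearMap.apply ℝ ℝ w).hasFDerivAt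
  rw [h.fderiv]
  exact bidualVector_eq_of_apply fun _ => rfl

theorem bidualVector_fderiv_apply_mul_add [FiniteDimensional ℝ E] (a b c d : E)
    (μ : E →L[ℝ] ℝ) :
    bidualVector (fderiv ℝ (fun ν : E →L[ℝ] ℝ => ν a * ν b + ν c * ν d) μ) =
      μ a • b + μ b • a + (μ c • d + μ d • c) := by
  have h (w : E) : HasFDerivAt (fun ν : E →L[ℝ] ℝ => ν w) (ContinuousLinearMap.apply ℝ ℝ w) μ :=
    (ContinuousLinearMap.apply ℝ ℝ w).hasFDerivAt
  rw [(((h a).fun_mul (h b)).fun_add ((h c).fun_mul (h d))).fderiv]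
  refine bidualVector_eq_of_apply fun ν => ?_
  simp

theorem contDiff_eval (w : E) : ContDiff ℝ ∞ (fun ν : E →L[ℝ] ℝ => ν w) :=
  (ContinuousLinearMap.apply ℝ ℝ w).contDiff

/-- There are `n - 1` functions on `E*` in involution for the Lie-Poisson bracket of `β`, with
differentials independent on a dense set. -/
def HasCommutingFamily [FiniteDimensional ℝ E] (β : E →L[ℝ] E →L[ℝ] E) : Prop :=
  ∃ (ι : Type) (_ : Fintype ι) (k : ι → (E →L[ℝ] ℝ) → ℝ),
    Fintype.card ι + 1 = Module.finrank ℝ E ∧ (∀ i, ContDiff ℝ ∞ (k i)) ∧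
    (∀ i j (μ : E →L[ℝ] ℝ),
      μ (β (bidualVector (fderiv ℝ (k i) μ)) (bidualVector (fderiv ℝ (k j) μ))) = 0) ∧
    Dense {μ | LinearIndependent ℝ fun i => bidualVector (fderiv ℝ (k i) μ)}

theorem hasCommutingFamily_of_abelian_hyperplane [FiniteDimensional ℝ E]
    {β : E →L[ℝ] E →L[ℝ] E} {V : Submodule ℝ E}
    (hV : Module.finrank ℝ V + 1 = Module.finrank ℝ E) (hβ : ∀ a ∈ V, ∀ b ∈ V, β a b = 0) :
    HasCommutingFamily β := by
  let e := Module.finBasis ℝ V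
  refine ⟨Fin (Module.finrank ℝ V), inferInstance, fun i μ => μ (e i), by simpa using hV,
    fun i => contDiff_eval _, fun i j μ => ?_, ?_⟩
  · rw [bidualVector_fderiv_apply, bidualVector_fderiv_apply, hβ _ (e i).2 _ (e j).2, map_zero]
  · simp only [bidualVector_fderiv_apply]
    have h : LinearIndependent ℝ fun i => (e i : E) :=
      e.linearIndependent.map' V.subtype V.ker_subtype
    simp [h]

theorem hasCommutingFamily_of_independent_brackets [FiniteDimensional ℝ E]
    {β : E →L[ℝ] E →L[ℝ] E} (hs : ∀ a b, β a b = -β b a)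
    (hj : ∀ a b c, β a (β b c) = β (β a b) c + β b (β a c)) {e₁ e₂ e₃ : E}
    (hdec : ∀ v, ∃ (a b c : ℝ) (z : E), v = a • e₁ + b • e₂ + c • e₃ + z ∧ ∀ u, β z u = 0)
    (hind : ∀ a b c : ℝ, a • β e₂ e₃ + b • β e₃ e₁ + c • β e₁ e₂ = 0 → a = 0 ∧ b = 0 ∧ c = 0) :
    HasCommutingFamily β := by
  have hself : ∀ a, β a a = 0 := fun a => by
    have h2 : (2 : ℝ) • β a a = 0 := by
      rw [two_smul]; nth_rw 2 [hs]; exact add_neg_cancel _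
    exact (smul_eq_zero.1 h2).resolve_left two_ne_zero
  set f₁ := β e₂ e₃ with hf₁
  set f₂ := β e₃ e₁ with hf₂
  set f₃ := β e₁ e₂ with hf₃
  have h13 : β e₁ e₃ = -f₂ := hs _ _
  have h21 : β e₂ e₁ = -f₃ := hs _ _
  obtain ⟨a₁, b₁, c₁, z₁, d₁, hz₁⟩ := hdec f₁
  obtain ⟨a₂, b₂, c₂, z₂, d₂, hz₂⟩ := hdec f₂
  obtain ⟨a₃, b₃, c₃, z₃, d₃, hz₃⟩ := hdec f₃
  have hz' : ∀ z, (∀ u, β z u = 0) → ∀ u, β u z = 0 := fun z hz u => by rw [hs, hz, neg_zero]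
  -- The Jacobi identity on `e₁, e₂, e₃` makes the coefficient matrix of the brackets symmetric.
  -- Only this entry is used.
  have hsym : c₂ = b₃ := by
    have h1 : β e₁ f₁ = b₁ • f₃ - c₁ • f₂ := by
      rw [d₁]
      simp only [map_add, map_smul, hself, h13, hz' z₁ hz₁, ← hf₃]
      module
    have h2 : β f₃ e₃ = b₃ • f₁ - a₃ • f₂ := by
      rw [d₃]
      simp only [map_add, map_smul, add_apply, smul_apply, hself, h13, hz₃, ← hf₁]
      module
    have h3 : β e₂ f₂ = c₂ • f₁ - a₂ • f₃ := by
      rw [d₂]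
      simp only [map_add, map_smul, hself, h21, hz' z₂ hz₂, ← hf₁]
      module
    have h4 := hj e₁ e₂ e₃
    rw [← hf₁, ← hf₃, h13, map_neg, h1, h2, h3, ← sub_eq_zero] at h4
    have h5 : (c₂ - b₃) • f₁ + (a₃ - c₁) • f₂ + (b₁ - a₂) • f₃ = 0 := by
      rw [← h4]; module
    linarith [(hind _ _ _ h5).1]
  let W := LinearMap.ker (β e₁).toLinearMap
  have hmemW : ∀ w ∈ W, ∃ (a : ℝ) (z : E), w = a • e₁ + z ∧ ∀ u, β z u = 0 := by
    intro w hw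
    obtain ⟨a, b, c, z, rfl, hz⟩ := hdec w
    have h1 : β e₁ (a • e₁ + b • e₂ + c • e₃ + z) = 0 := hw
    simp only [map_add, map_smul, hself, h13, hz' z hz, ← hf₃] at h1
    have h2 : (0 : ℝ) • f₁ + (-c) • f₂ + b • f₃ = 0 := by rw [← h1]; module
    obtain ⟨-, hc, hb⟩ := hind _ _ _ h2
    exact ⟨a, z, by rw [hb, neg_eq_zero.1 hc]; module, hz⟩
  have hW : Module.finrank ℝ W + 2 = Module.finrank ℝ E := by
    have h1 := LinearMap.finrank_range_add_finrank_ker (β e₁).toLinearMap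
    have hli : LinearIndependent ℝ ![f₂, f₃] := by
      rw [LinearIndependent.pair_iff]
      intro s t h
      exact (hind 0 s t (by rw [← h]; module)).2
    have hr : LinearMap.range (β e₁).toLinearMap = Submodule.span ℝ (Set.range ![f₂, f₃]) := by
      apply le_antisymm
      · rintro _ ⟨v, rfl⟩
        obtain ⟨a, b, c, z, rfl, hz⟩ := hdec v
        rw [Matrix.range_cons_cons_empty, Submodule.mem_span_pair]
        refine ⟨-c, b, ?_⟩
        simp only [ContinuousLinearMap.coe_coe, map_add, map_smul, hself, h13, hz' z hz, ← hf₃]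
        module
      · rw [Submodule.span_le, Matrix.range_cons_cons_empty]
        rintro v (rfl | rfl)
        · exact ⟨-e₃, by simp [h13]⟩
        · exact ⟨e₂, rfl⟩
    rw [hr, finrank_span_eq_card hli] at h1
    simp only [Fintype.card_fin] at h1
    rw [← h1, add_comm]
  -- The centralizer `W` of `e₁` is spanned by `e₁` and central elements, so it is abelian of
  -- dimension `n - 2` and supplies all but one of the functions.
  let e := Module.finBasis ℝ W
  let w₂ := a₂ • e₁ + z₂
  let w₃ := a₃ • e₁ + z₃
  -- The quadratic Casimir of the algebra with its terms in `e₁` and the centre alone removed. By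
  -- `hsym` its gradient is `2 (f₂ e₂ + f₃ e₃)` modulo `W`, so its bracket with `e₁` is `2 (f₂ f₃ -
  -- f₃ f₂) = 0`.
  let C : (E →L[ℝ] ℝ) → ℝ := fun ν => ν e₂ * ν (f₂ + w₂) + ν e₃ * ν (f₃ + w₃)
  let k : Option (Fin (Module.finrank ℝ W)) → (E →L[ℝ] ℝ) → ℝ := fun o =>
    o.elim C fun i ν => ν (e i)
  have hk : ∀ i μ, bidualVector (fderiv ℝ (k (some i)) μ) = e i := fun i μ =>
    bidualVector_fderiv_apply (e i : E) μ
  have hC : ∀ μ : E →L[ℝ] ℝ, bidualVector (fderiv ℝ (k none) μ) =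
      (2 * μ f₂) • e₂ + (2 * μ f₃) • e₃ + ((2 * μ e₂) • w₂ + (2 * μ e₃) • w₃) := by
    intro μ
    refine (bidualVector_fderiv_apply_mul_add _ _ _ _ _).trans ?_
    have h2 : f₂ = b₂ • e₂ + c₂ • e₃ + w₂ := by rw [d₂]; simp only [w₂]; module
    have h3 : f₃ = c₂ • e₂ + c₃ • e₃ + w₃ := by rw [d₃, hsym]; simp only [w₃]; module
    rw [h2, h3]
    simp only [map_add, map_smul, smul_eq_mul]
    module
  have hw₂ : ∀ u ∈ W, β u w₂ = 0 := by
    intro u hu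
    obtain ⟨a, z, rfl, hz⟩ := hmemW u hu
    simp [w₂, hself, hz, hz' z₂ hz₂]
  have hw₃ : ∀ u ∈ W, β u w₃ = 0 := by
    intro u hu
    obtain ⟨a, z, rfl, hz⟩ := hmemW u hu
    simp [w₃, hself, hz, hz' z₃ hz₃]
  have he₁ : e₁ ∈ W := hself e₁
  have hCe : ∀ μ, β e₁ (bidualVector (fderiv ℝ (k none) μ)) =
      (2 * μ f₂) • f₃ - (2 * μ f₃) • f₂ := by
    intro μ
    rw [hC]
    simp only [map_add, map_smul, hw₂ e₁ he₁, hw₃ e₁ he₁, h13, ← hf₃]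
    module
  have hCW : ∀ u ∈ W, ∀ μ : E →L[ℝ] ℝ, μ (β u (bidualVector (fderiv ℝ (k none) μ))) = 0 := by
    intro u hu μ
    obtain ⟨a, z, rfl, hz⟩ := hmemW u hu
    simp only [map_add, map_smul, add_apply, smul_apply, hz, hCe, map_sub, smul_eq_mul, add_zero]
    ring
  refine ⟨Option (Fin (Module.finrank ℝ W)), inferInstance, k, by simpa using hW, ?_, ?_, ?_⟩
  · rintro (_ | i)
    · exact ((contDiff_eval _).mul (contDiff_eval _)).add ((contDiff_eval _).mul (contDiff_eval _))
    · exact contDiff_eval _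
  · rintro (_ | i) (_ | j) μ
    · rw [hself, map_zero]
    · rw [hs, map_neg, hk, hCW _ (e j).2, neg_zero]
    · rw [hk, hCW _ (e i).2]
    · rw [hk, hk]
      obtain ⟨a, z, h1, hz⟩ := hmemW _ (e i).2
      obtain ⟨b, y, h2, hy⟩ := hmemW _ (e j).2
      rw [h1, h2]
      simp [hself, hz, hz' y hy]
  · have hne : f₂ ≠ 0 := by
      intro h0
      have := (hind 0 1 0 (by rw [h0]; module)).2.1
      exact one_ne_zero this
    -- Where `μ f₂ ≠ 0` the gradient of `C` does not commute with `e₁`, because `f₂` and `f₃` are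
    -- independent; it therefore lies outside `W`.
    refine (dense_apply_ne_zero hne).mono fun μ hμ => ?_
    refine linearIndependent_option.2 ⟨?_, fun hmem => hμ ?_⟩
    · have h : LinearIndependent ℝ fun i => (e i : E) :=
        e.linearIndependent.map' W.subtype W.ker_subtype
      have hfun : (fun i => bidualVector (fderiv ℝ (k i) μ)) ∘ some = fun i => (e i : E) :=
        funext fun i => hk i μ
      rw [hfun]
      exact h
    · have hle : Submodule.span ℝ (Set.range
          ((fun i => bidualVector (fderiv ℝ (k i) μ)) ∘ some)) ≤ W := by
        rw [Submodule.span_le]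
        rintro _ ⟨i, rfl⟩
        simp only [Function.comp_apply, hk]
        exact (e i).2
      have h1 : β e₁ (bidualVector (fderiv ℝ (k none) μ)) = 0 := hle hmem
      rw [hCe] at h1
      have h2 := (hind 0 (-(2 * μ f₃)) (2 * μ f₂) (by rw [← h1]; module)).2.2
      linarith

theorem hasCommutingFamily [FiniteDimensional ℝ E]
    {β : E →L[ℝ] E →L[ℝ] E} (hs : ∀ a b, β a b = -β b a)
    (hj : ∀ a b c, β a (β b c) = β (β a b) c + β b (β a c)) (hp : IsDecomposable β)
    (hβ : ∃ a b, β a b ≠ 0) : HasCommutingFamily β := by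
  rcases exists_abelian_hyperplane_or hs hp hβ with ⟨V, hV, hV'⟩ | ⟨e₁, e₂, e₃, hdec, hind⟩
  · exact hasCommutingFamily_of_abelian_hyperplane hV hV'
  · exact hasCommutingFamily_of_independent_brackets hs hj hdec hind

end CommutingFamilies

/-! ### Making a function non-invariant on a dense set. -/

section GenericPerturbation

variable {F : Type*} [NormedAddCommGroup F] [NormedSpace ℝ F]

theorem isOpen_exists_fderiv_apply_ne {ι : Type*} {X : ι → F → F} (hX : ∀ i, Continuous (X i))
    {h : F → ℝ} (hh : ContDiff ℝ ∞ h) : IsOpen {μ | ∃ i, fderiv ℝ h μ (X i μ) ≠ 0} := by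
  have : {μ | ∃ i, fderiv ℝ h μ (X i μ) ≠ 0} = ⋃ i, {μ | fderiv ℝ h μ (X i μ) ≠ 0} := by
    ext μ; simp
  rw [this]
  exact isOpen_iUnion fun i => isOpen_ne_fun
    ((hh.continuous_fderiv (by simp)).clm_apply (hX i)) continuous_const

/-- A smooth function can be changed, away from the closure of the set where some of the given
fields move it, so that it becomes non-invariant on a dense set. -/
theorem exists_generic_perturbation [FiniteDimensional ℝ F] {ι : Type*} {X : ι → F → F}
    (hX : ∀ i, Continuous (X i)) {h : F → ℝ} (hh : ContDiff ℝ ∞ h) (l : F →L[ℝ] ℝ) (j : ι)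
    (hl : Dense {μ | l (X j μ) ≠ 0}) :
    ∃ f : F → ℝ, ContDiff ℝ ∞ f ∧
      (∀ μ, fderiv ℝ f μ = fderiv ℝ h μ ∨ ∀ i, fderiv ℝ h μ (X i μ) = 0) ∧
      Dense {μ | ∃ i, fderiv ℝ f μ (X i μ) ≠ 0} := by
  set N := {μ | ∃ i, fderiv ℝ h μ (X i μ) ≠ 0} with hN
  set O := (closure N)ᶜ with hO
  have hOo : IsOpen O := isClosed_closure.isOpen_compl
  have hON : ∀ μ ∈ O, ∀ i, fderiv ℝ h μ (X i μ) = 0 := by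
    intro μ hμ i
    by_contra hne
    exact hμ (subset_closure ⟨i, hne⟩)
  obtain ⟨χ, hsupp, hχ, hrange⟩ := hOo.exists_contDiff_support_eq (n := ⊤)
  have hχd : Differentiable ℝ χ := hχ.differentiable (by simp)
  have hhd : Differentiable ℝ h := hh.differentiable (by simp)
  have hχ0 : ∀ μ, 0 ≤ χ μ := fun μ => (hrange (Set.mem_range_self μ)).1
  -- The bump `χ` is nonnegative with support exactly `O`. Outside `O` it is at its minimum, so `f
  -- t` and `h` have the same differential there.
  let f : ℝ → F → ℝ := fun t μ => h μ + χ μ * Real.exp (t * l μ)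
  have hf : ∀ t, ContDiff ℝ ∞ (f t) := fun t =>
    hh.add (hχ.mul (Real.contDiff_exp.comp (contDiff_const.mul l.contDiff)))
  have hfd : ∀ t μ, fderiv ℝ (f t) μ = fderiv ℝ h μ +
      Real.exp (t * l μ) • (fderiv ℝ χ μ + (t * χ μ) • l) := by
    intro t μ
    have h1 := (hhd μ).hasFDerivAt.fun_add ((hχd μ).hasFDerivAt.fun_mul
      (((l.hasFDerivAt (x := μ)).const_mul t).exp))
    rw [h1.fderiv]
    ext v
    simp
    ring
  have hnot : ∀ t, ∀ μ ∉ O, fderiv ℝ (f t) μ = fderiv ℝ h μ := by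
    intro t μ hμ
    have h0 : χ μ = 0 := by
      rw [← hsupp] at hμ
      exact Function.notMem_support.1 hμ
    have h1 : fderiv ℝ χ μ = 0 := by
      refine IsLocalMin.fderiv_eq_zero (Filter.Eventually.of_forall fun ν => ?_)
      rw [h0]; exact hχ0 ν
    rw [hfd, h0, h1]
    simp
  -- The bad set for `t`: the points of `O` where `l (X j μ) ≠ 0` yet `X j` does not move `f t`. The
  -- condition is affine in `t` with nonzero slope, so these sets are disjoint. Only countably many
  -- can have interior, and an uncountable parameter leaves a good `t`.
  let S : ℝ → Set F := fun t => {μ | μ ∈ O ∧ l (X j μ) ≠ 0 ∧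
    fderiv ℝ χ μ (X j μ) + t * χ μ * l (X j μ) = 0}
  have hS : ∃ t, interior (S t) = ∅ := by
    by_contra hcon
    push Not at hcon
    have hdisj : (Set.univ : Set ℝ).PairwiseDisjoint S := by
      intro t _ t' _ hne
      refine Set.disjoint_left.2 fun μ h1 h2 => hne ?_
      have hc : χ μ ≠ 0 := by
        have := h1.1
        rw [← hsupp] at this
        exact this
      have h3 : (t - t') * (χ μ * l (X j μ)) = 0 := by linear_combination h1.2.2 - h2.2.2
      exact sub_eq_zero.1 ((mul_eq_zero.1 h3).resolve_right (mul_ne_zero hc h1.2.1))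
    have : (Set.univ : Set ℝ).Countable :=
      hdisj.countable_of_nonempty_interior fun t _ => hcon t
    exact Set.not_countable_univ this
  obtain ⟨t, ht⟩ := hS
  refine ⟨f t, hf t, fun μ => ?_, ?_⟩
  · by_cases hμ : μ ∈ O
    · exact Or.inr (hON μ hμ)
    · exact Or.inl (hnot t μ hμ)
  · rw [dense_iff_inter_open]
    intro V hV hVne
    by_contra hemp
    have hzero : ∀ μ ∈ V, ∀ i, fderiv ℝ (f t) μ (X i μ) = 0 := by
      intro μ hμ i
      by_contra hne
      exact hemp ⟨μ, hμ, i, hne⟩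
    have hVN : Disjoint V N := by
      refine Set.disjoint_left.2 fun μ hμ hμN => ?_
      have hμO : μ ∉ O := fun h => h (subset_closure hμN)
      obtain ⟨i, hi⟩ := hμN
      rw [← hnot t μ hμO] at hi
      exact hi (hzero μ hμ i)
    have hVO : ∀ μ ∈ V, μ ∈ O := fun μ hμ => Set.disjoint_left.1 (hVN.closure_right hV) hμ
    obtain ⟨μ, hμV, hμl⟩ := hl.inter_open_nonempty V hV hVne
    have hsub : V ∩ {μ | l (X j μ) ≠ 0} ⊆ S t := by
      rintro ν ⟨hν, hνl⟩
      refine ⟨hVO ν hν, hνl, ?_⟩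
      have h1 := hzero ν hν j
      rw [hfd, add_apply, hON ν (hVO ν hν), zero_add, smul_apply, add_apply, smul_apply,
        smul_eq_mul, smul_eq_mul] at h1
      exact (mul_eq_zero.1 h1).resolve_left (Real.exp_pos _).ne'
    have hopen : IsOpen (V ∩ {μ | l (X j μ) ≠ 0}) :=
      hV.inter (isOpen_ne_fun (l.continuous.comp (hX j)) continuous_const)
    have : μ ∈ interior (S t) := interior_maximal hsub hopen ⟨hμV, hμl⟩
    rw [ht] at this
    exact this

end GenericPerturbation
end

/-! ### Linear independence criteria for differentials. -/

noncomputable section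

section LinearAlgebra

variable {E F ι : Type*} [NormedAddCommGroup E] [NormedSpace ℝ E] [NormedAddCommGroup F]
  [NormedSpace ℝ F]

theorem linearIndependent_functionals_of_injective {w : ι → E} (hw : LinearIndependent ℝ w)
    (L : E →ₗ[ℝ] F →L[ℝ] ℝ) (hL : ∀ v, L v = 0 → v = 0) : LinearIndependent ℝ fun i => L (w i) :=
  hw.map' L (LinearMap.ker_eq_bot'.2 hL)

theorem linearIndependent_of_functionals {φ : ι → F →L[ℝ] ℝ} (hφ : LinearIndependent ℝ φ)
    (L : (F →L[ℝ] ℝ) →ₗ[ℝ] E) (hL : ∀ ψ, L ψ = 0 → ψ = 0) :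
    LinearIndependent ℝ fun i => L (φ i) :=
  hφ.map' L (LinearMap.ker_eq_bot'.2 hL)

/-- `A` isolates the coefficient of `p` and `B` that of `q`. In the application both are Poisson
brackets with a momentum component. -/
theorem linearIndependent_sumElim_pair [Fintype ι] {v : ι → F →L[ℝ] ℝ} {p q : F →L[ℝ] ℝ}
    (hv : LinearIndependent ℝ v) (A B : (F →L[ℝ] ℝ) →ₗ[ℝ] ℝ) (hAv : ∀ i, A (v i) = 0)
    (hAp : A p ≠ 0) (hAq : A q = 0) (hBv : ∀ i, B (v i) = 0) (hBp : B p = 0) (hBq : B q ≠ 0) :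
    LinearIndependent ℝ (Sum.elim v ![p, q]) := by
  rw [Fintype.linearIndependent_iff]
  intro g hg
  rw [Fintype.sum_sum_type, Fin.sum_univ_two] at hg
  simp only [Sum.elim_inl, Sum.elim_inr, Matrix.cons_val_zero, Matrix.cons_val_one] at hg
  have h0 : g (Sum.inr 0) = 0 := by
    have := congrArg A hg
    simpa [hAv, hAq, hAp] using this
  have h1 : g (Sum.inr 1) = 0 := by
    have := congrArg B hg
    simpa [hBv, hBp, hBq] using this
  rw [h0, h1, zero_smul, zero_smul, add_zero, add_zero] at hg
  have h2 := Fintype.linearIndependent_iff.1 hv _ hg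
  rintro (i | i)
  · exact h2 i
  · fin_cases i
    · exact h0
    · exact h1

theorem linearIndependent_option_of_apply {v : Option ι → F →L[ℝ] ℝ}
    (hv : LinearIndependent ℝ fun i => v (some i)) (A : (F →L[ℝ] ℝ) →ₗ[ℝ] ℝ)
    (hA : ∀ i, A (v (some i)) = 0) (hA' : A (v none) ≠ 0) : LinearIndependent ℝ v := by
  refine linearIndependent_option.2 ⟨hv, fun hmem => hA' ?_⟩
  have hle : Submodule.span ℝ (Set.range (v ∘ some)) ≤ LinearMap.ker A := by
    rw [Submodule.span_le]
    rintro _ ⟨i, rfl⟩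
    exact hA i
  exact hle hmem

theorem isOpen_inter_linearIndependent_fderiv [Finite ι] {C : ι → F → ℝ} {U : Set F} (hU : IsOpen U)
    (hC : ∀ i, ContDiffOn ℝ ∞ (C i) U) :
    IsOpen {ν | ν ∈ U ∧ LinearIndependent ℝ (fun i => fderiv ℝ (C i) ν)} := by
  have hcont : ContinuousOn (fun ν i => fderiv ℝ (C i) ν) U := continuousOn_pi.2 fun i =>
    (hC i).continuousOn_fderiv_of_isOpen hU (by simp)
  exact hcont.isOpen_inter_preimage hU isOpen_setOfPred_linearIndependent

end LinearAlgebra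

/-! ### Casimirs, complete systems of integrals, and the main theorem. -/

section Integrability

variable {E : Type*} [NormedAddCommGroup E] [NormedSpace ℝ E] [FiniteDimensional ℝ E]

theorem linearIndependent_bidualVector {ι : Type*} {φ : ι → (E →L[ℝ] ℝ) →L[ℝ] ℝ}
    (h : LinearIndependent ℝ φ) : LinearIndependent ℝ fun i => bidualVector (φ i) := by
  let b : ((E →L[ℝ] ℝ) →L[ℝ] ℝ) →ₗ[ℝ] E :=
    { toFun := bidualVector, map_add' := bidualVector_add, map_smul' := bidualVector_smul }
  refine linearIndependent_of_functionals h b fun ψ hψ => ?_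
  ext μ
  have h0 : bidualVector ψ = 0 := hψ
  rw [← apply_bidualVector, h0, map_zero]
  rfl

theorem poissonBivectorLeft_skew (α β : (E × (E →L[ℝ] ℝ)) →L[ℝ] ℝ) :
    poissonBivectorLeft α β = -poissonBivectorLeft β α := by
  change poissonBivector β α = -poissonBivector α β
  simp only [poissonBivector, neg_sub]

variable {G : Type*} [TopologicalSpace G] [ChartedSpace E G] [Group G] [LieGroup 𝓘(ℝ, E) ∞ G]

theorem poissonBivectorLeft_right_right (x : CotangentBundle E G) (η ζ : E) :
    poissonBivectorLeft (componentDiff rightMomentum x ζ) (componentDiff rightMomentum x η) =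
      -rightMomentum x (algBracket G η ζ) := by
  rw [componentDiff_apply contMDiff_rightMomentum, componentDiff_apply contMDiff_rightMomentum,
    ← poissonBracket_eq_bivector, poissonBracket_rightMomentum]

theorem poissonBivectorLeft_left_left (x : CotangentBundle E G) (η ζ : E) :
    poissonBivectorLeft (componentDiff leftMomentum x ζ) (componentDiff leftMomentum x η) =
      leftMomentum x (algBracket G η ζ) := by
  rw [componentDiff_apply contMDiff_leftMomentum, componentDiff_apply contMDiff_leftMomentum,
    ← poissonBracket_eq_bivector, poissonBracket_leftMomentum]

theorem poissonBivectorLeft_left_right (x : CotangentBundle E G) (η ζ : E) :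
    poissonBivectorLeft (componentDiff leftMomentum x ζ) (componentDiff rightMomentum x η) = 0 := by
  rw [componentDiff_apply contMDiff_leftMomentum, componentDiff_apply contMDiff_rightMomentum,
    ← poissonBracket_eq_bivector, poissonBracket_rightMomentum_leftMomentum]

theorem poissonBivectorLeft_right_left (x : CotangentBundle E G) (η ζ : E) :
    poissonBivectorLeft (componentDiff rightMomentum x ζ) (componentDiff leftMomentum x η) = 0 := by
  rw [poissonBivectorLeft_skew, poissonBivectorLeft_left_right, neg_zero]

theorem algBracketCLM_skew (a b : E) : algBracketCLM G a b = -algBracketCLM G b a := by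
  have : CompleteSpace E := FiniteDimensional.complete ℝ E
  exact (algBracket_skew (G := G) a b).symm

theorem algBracketCLM_leibniz (a b c : E) : algBracketCLM G a (algBracketCLM G b c) =
    algBracketCLM G (algBracketCLM G a b) c + algBracketCLM G b (algBracketCLM G a c) := by
  have : CompleteSpace E := FiniteDimensional.complete ℝ E
  exact algBracket_leibniz (G := G) a b c

theorem algBracket_self (a : E) : algBracket G a a = 0 := by
  have : CompleteSpace E := FiniteDimensional.complete ℝ E
  have h := algBracket_skew (G := G) a a
  have h2 : (2 : ℝ) • algBracket G a a = 0 := by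
    rw [two_smul]; nth_rw 2 [← h]; exact add_neg_cancel _
  exact (smul_eq_zero.1 h2).resolve_left two_ne_zero

/-- The Hamiltonian vector field of `f` on `𝔤*`, paired with `η`. -/
theorem apply_algBracket_bidualVector (f : (E →L[ℝ] ℝ) → ℝ) (μ : E →L[ℝ] ℝ) (η : E) :
    μ (algBracket G (bidualVector (fderiv ℝ f μ)) η) =
      -fderiv ℝ f μ (coadField (algBracketCLM G) η μ) := by
  rw [← apply_bidualVector (fderiv ℝ f μ), coadField_apply, algBracketCLM_skew, map_neg, neg_neg]
  rfl

theorem exists_apply_algBracket_ne_zero {μ : E →L[ℝ] ℝ} (hμ : coadjointOrbitDim G μ = 2) :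
    ∃ ξ η, μ (algBracketCLM G ξ η) ≠ 0 := by
  by_contra hcon
  push Not at hcon
  have h0 : coadjointForm G μ = 0 := by
    ext ξ η
    exact hcon ξ η
  rw [coadjointOrbitDim_eq, h0, LinearMap.range_zero, finrank_bot] at hμ
  omega

/-- Local Casimirs around a point of a two-dimensional coadjoint orbit. -/
theorem exists_local_casimirs (hp : IsDecomposable (algBracketCLM (E := E) G))
    {μ : E →L[ℝ] ℝ} (hμ : coadjointOrbitDim G μ = 2) :
    ∃ U : Set (E →L[ℝ] ℝ), IsOpen U ∧ μ ∈ U ∧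
      ∃ C : Fin (Module.finrank ℝ E - 2) → (E →L[ℝ] ℝ) → ℝ,
        (∀ i, IsCasimirOn G (C i) U) ∧
        ∀ ν ∈ U, LinearIndependent ℝ (fun i => fderiv ℝ (C i) ν) := by
  obtain ⟨ξ, η, hne⟩ := exists_apply_algBracket_ne_zero hμ
  obtain ⟨U, hU, hμU, C, hC, hinv, hli⟩ :=
    exists_local_invariants algBracketCLM_skew algBracketCLM_leibniz hp hne
  refine ⟨U, hU, hμU, C, fun i => ⟨hC i, fun k _ ν hν => ?_⟩, hli⟩
  rw [liePoissonBracket, apply_algBracket_bidualVector, hinv ν hν, neg_zero]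

/-- Test the Casimir condition on the linear function `ν ↦ ν η`, whose differential is `η`. -/
theorem IsCasimirOn.apply_algBracket {C : (E →L[ℝ] ℝ) → ℝ} {U : Set (E →L[ℝ] ℝ)}
    (hC : IsCasimirOn G C U) {μ : E →L[ℝ] ℝ} (hμ : μ ∈ U) (η : E) :
    μ (algBracket G (bidualVector (fderiv ℝ C μ)) η) = 0 := by
  have h := hC.casimir (fun ν => ν η) (contDiff_eval η) μ hμ
  rwa [liePoissonBracket, bidualVector_fderiv_apply] at h

theorem linearIndependent_componentDiff_right {ι : Type*} {w : ι → E}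
    (hw : LinearIndependent ℝ w) (x : CotangentBundle E G) :
    LinearIndependent ℝ fun i => componentDiff rightMomentum x (w i) :=
  linearIndependent_functionals_of_injective hw _ fun _ => eq_zero_of_componentDiff_rightMomentum

theorem linearIndependent_componentDiff_left {ι : Type*} {w : ι → E}
    (hw : LinearIndependent ℝ w) (x : CotangentBundle E G) :
    LinearIndependent ℝ fun i => componentDiff leftMomentum x (w i) :=
  linearIndependent_functionals_of_injective hw _ fun _ => eq_zero_of_componentDiff_leftMomentum

variable (G) in
/-- The points of `𝔤*` where the Hamiltonian vector field of `f` does not vanish. -/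
def nonCasimirSet (f : (E →L[ℝ] ℝ) → ℝ) : Set (E →L[ℝ] ℝ) :=
  {μ | ∃ η, μ (algBracket G (bidualVector (fderiv ℝ f μ)) η) ≠ 0}

theorem nonCasimirSet_eq (f : (E →L[ℝ] ℝ) → ℝ) : nonCasimirSet G f =
    {μ | ∃ η, fderiv ℝ f μ (coadField (algBracketCLM G) η μ) ≠ 0} := by
  ext μ
  simp only [nonCasimirSet, apply_algBracket_bidualVector, neg_ne_zero]

theorem isOpen_nonCasimirSet {f : (E →L[ℝ] ℝ) → ℝ} (hf : ContDiff ℝ ∞ f) :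
    IsOpen (nonCasimirSet G f) := by
  rw [nonCasimirSet_eq]
  exact isOpen_exists_fderiv_apply_ne (X := fun η μ => coadField (algBracketCLM G) η μ)
    (fun η => (coadField (algBracketCLM G) η).continuous) hf

theorem isNowhereCasimir_iff {h : (E →L[ℝ] ℝ) → ℝ} (hh : ContDiff ℝ ∞ h) :
    IsNowhereCasimir (fun x : CotangentBundle E G => h (rightMomentum x)) ↔
      Dense (rightMomentum ⁻¹' nonCasimirSet G h : Set (CotangentBundle E G)) := by
  have h1 : {x : CotangentBundle E G | ∃ η : E, poissonBracket
      (fun x : CotangentBundle E G => h (rightMomentum x)) (fun y => rightMomentum y η) x ≠ 0} =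
      rightMomentum ⁻¹' nonCasimirSet G h := by
    ext x
    refine exists_congr fun η => ?_
    rw [poissonBracket_eq_bivector, cotangentDiff_comp contMDiff_rightMomentum
      (hh.differentiable (by simp) _), ← componentDiff_apply contMDiff_rightMomentum,
      poissonBivectorLeft_right_right, neg_ne_zero]
  rw [IsNowhereCasimir, h1]

/-- Every smooth function on `𝔤*` commutes with one whose Hamiltonian field is nonzero on a dense
set. -/
theorem exists_commuting_nowhere_casimir (hβ : ∃ a b : E, algBracketCLM G a b ≠ 0)
    {h : (E →L[ℝ] ℝ) → ℝ} (hh : ContDiff ℝ ∞ h) :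
    ∃ f : (E →L[ℝ] ℝ) → ℝ, ContDiff ℝ ∞ f ∧
      (∀ μ : E →L[ℝ] ℝ, μ (algBracket G (bidualVector (fderiv ℝ f μ))
        (bidualVector (fderiv ℝ h μ))) = 0) ∧
      Dense (nonCasimirSet G f) := by
  obtain ⟨a, b, hab⟩ := hβ
  obtain ⟨f, hf, hfh, hd⟩ := exists_generic_perturbation
    (X := fun η μ => coadField (algBracketCLM G) η μ)
    (fun η => (coadField (algBracketCLM G) η).continuous) hh (ContinuousLinearMap.apply ℝ ℝ b) a
    (dense_apply_ne_zero hab)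
  refine ⟨f, hf, fun μ => ?_, by rwa [nonCasimirSet_eq]⟩
  -- At each point either `f` and `h` have equal differentials, and skewness applies, or the
  -- Hamiltonian vector of `h` vanishes.
  rcases hfh μ with h1 | h1
  · rw [h1, algBracket_self, map_zero]
  · rw [← algBracketCLM_apply, algBracketCLM_skew, map_neg, algBracketCLM_apply,
      apply_algBracket_bidualVector, h1, neg_zero, neg_zero]

/-- A maximal commuting family of `𝔤*` on the left and one function on the right form a complete
system of integrals. -/
theorem exists_completeSystem (hk : HasCommutingFamily (algBracketCLM (E := E) G))
    {h f : (E →L[ℝ] ℝ) → ℝ} (hh : ContDiff ℝ ∞ h) (hf : ContDiff ℝ ∞ f)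
    (hfh : ∀ μ : E →L[ℝ] ℝ, μ (algBracket G (bidualVector (fderiv ℝ f μ))
      (bidualVector (fderiv ℝ h μ))) = 0)
    (hd : Dense (rightMomentum ⁻¹' nonCasimirSet G f : Set (CotangentBundle E G))) :
    ∃ F : Fin (Module.finrank ℝ E) → CotangentBundle E G → ℝ,
      IsCompleteSystemOfIntegrals (fun x => h (rightMomentum x)) F ∧
      ∃ i, F i = fun x => f (rightMomentum x) := by
  obtain ⟨ι, _, k, hcard, hks, hkk, hkd⟩ := hk
  let K : Option ι → CotangentBundle E G → ℝ := fun o =>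
    o.elim (fun x => f (rightMomentum x)) fun i x => k i (leftMomentum x)
  have hK0 : ∀ x, cotangentDiff (K none) x =
      componentDiff rightMomentum x (bidualVector (fderiv ℝ f (rightMomentum x))) := fun x =>
    cotangentDiff_comp contMDiff_rightMomentum (hf.differentiable (by simp) _)
  have hK1 : ∀ i x, cotangentDiff (K (some i)) x =
      componentDiff leftMomentum x (bidualVector (fderiv ℝ (k i) (leftMomentum x))) := fun i x =>
    cotangentDiff_comp contMDiff_leftMomentum ((hks i).differentiable (by simp) _)
  have hHd : ∀ x : CotangentBundle E G, cotangentDiff (fun x => h (rightMomentum x)) x =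
      componentDiff rightMomentum x (bidualVector (fderiv ℝ h (rightMomentum x))) := fun x =>
    cotangentDiff_comp contMDiff_rightMomentum (hh.differentiable (by simp) _)
  have hsmooth : ∀ o, IsSmoothOnCotangent (K o) := by
    rintro (_ | i)
    · exact hf.contMDiff.comp contMDiff_rightMomentum
    · exact (hks i).contMDiff.comp contMDiff_leftMomentum
  have hint : ∀ o x, poissonBracket (K o) (fun x => h (rightMomentum x)) x = 0 := by
    rintro (_ | i) x
    · rw [poissonBracket_eq_bivector, hHd, hK0, poissonBivectorLeft_right_right, hfh, neg_zero]
    · rw [poissonBracket_eq_bivector, hHd, hK1, poissonBivectorLeft_right_left]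
  have hinv : ∀ o o' x, poissonBracket (K o) (K o') x = 0 := by
    rintro (_ | i) (_ | j) x
    · rw [poissonBracket_eq_bivector, hK0, poissonBivectorLeft_right_right, algBracket_self,
        map_zero, neg_zero]
    · rw [poissonBracket_eq_bivector, hK0, hK1, poissonBivectorLeft_left_right]
    · rw [poissonBracket_eq_bivector, hK0, hK1, poissonBivectorLeft_right_left]
    · rw [poissonBracket_eq_bivector, hK1, hK1, poissonBivectorLeft_left_left]
      exact hkk i j _
  have hli : Dense {x | LinearIndependent ℝ fun o => cotangentDiff (K o) x} := by
    have hopen : IsOpen (rightMomentum ⁻¹' nonCasimirSet G f : Set (CotangentBundle E G)) :=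
      (isOpen_nonCasimirSet hf).preimage contMDiff_rightMomentum.continuous
    refine (hd.inter_of_isOpen_left (dense_leftMomentum_preimage hkd) hopen).mono ?_
    rintro x ⟨⟨η, hη⟩, hx⟩
    -- Bracketing with `⟨J_R, η⟩` kills every function of `J_L` but not `f ∘ J_R`, which splits that
    -- function off from the left family.
    refine linearIndependent_option_of_apply ?_
      (poissonBivectorLeft (componentDiff rightMomentum x η)) (fun i => ?_) ?_
    · simp only [hK1]
      exact linearIndependent_componentDiff_left hx x
    · rw [hK1, poissonBivectorLeft_right_left]
    · rw [hK0, poissonBivectorLeft_right_right, neg_ne_zero]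
      exact hη
  let e : Fin (Module.finrank ℝ E) ≃ Option ι :=
    (Fintype.equivFinOfCardEq (by rw [Fintype.card_option, hcard])).symm
  refine ⟨fun i => K (e i), ⟨fun i => hsmooth _, fun i => hint _, fun i j => hinv _ _, ?_⟩,
    e.symm none, ?_⟩
  · refine hli.mono fun x hx => ?_
    exact LinearIndependent.comp hx e e.injective
  · simp only [Equiv.apply_symm_apply]
    rfl

section CasimirFamily

variable {U : Set (E →L[ℝ] ℝ)} {C : Fin (Module.finrank ℝ E - 2) → (E →L[ℝ] ℝ) → ℝ}
  {h : (E →L[ℝ] ℝ) → ℝ}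

theorem cotangentDiff_casimirFamily (hU : IsOpen U) (hC : ∀ i, IsCasimirOn G (C i) U)
    (hh : ContDiff ℝ ∞ h) (ξ : E) {x : CotangentBundle E G} (hx : rightMomentum x ∈ U) :
    (fun i => cotangentDiff (casimirFamily C (fun x => h (rightMomentum x)) ξ i) x) =
      Sum.elim (fun i => componentDiff rightMomentum x
        (bidualVector (fderiv ℝ (C i) (rightMomentum x))))
        ![componentDiff rightMomentum x (bidualVector (fderiv ℝ h (rightMomentum x))),
          componentDiff leftMomentum x ξ] := by
  funext i
  rcases i with i | i
  · exact cotangentDiff_comp contMDiff_rightMomentum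
      (((hC i).smooth.contDiffAt (hU.mem_nhds hx)).differentiableAt (by simp))
  · fin_cases i
    · exact cotangentDiff_comp contMDiff_rightMomentum (hh.differentiable (by simp) _)
    · exact (componentDiff_apply contMDiff_leftMomentum x ξ).symm

theorem poissonBracket_casimirFamily (hU : IsOpen U) (hC : ∀ i, IsCasimirOn G (C i) U)
    (hh : ContDiff ℝ ∞ h) (ξ : E) {x : CotangentBundle E G} (hx : rightMomentum x ∈ U)
    (i j : Fin (Module.finrank ℝ E - 2) ⊕ Fin 2) :
    poissonBracket (casimirFamily C (fun x => h (rightMomentum x)) ξ i)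
      (casimirFamily C (fun x => h (rightMomentum x)) ξ j) x = 0 := by
  have hd := congrFun (cotangentDiff_casimirFamily hU hC hh ξ hx)
  have hcas : ∀ i (η : E), poissonBivectorLeft (componentDiff rightMomentum x η)
      (componentDiff rightMomentum x (bidualVector (fderiv ℝ (C i) (rightMomentum x)))) = 0 := by
    intro i η
    rw [poissonBivectorLeft_right_right, (hC i).apply_algBracket hx, neg_zero]
  rw [poissonBracket_eq_bivector, hd, hd]
  rcases i with i | i <;> rcases j with j | j
  · exact hcas i _
  · fin_cases j
    · exact hcas i _
    · exact poissonBivectorLeft_left_right x _ _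
  · fin_cases i
    · exact (poissonBivectorLeft_skew _ _).trans (by rw [Sum.elim_inl]; exact neg_eq_zero.2 (hcas j _))
    · exact poissonBivectorLeft_right_left x _ _
  · fin_cases i <;> fin_cases j
    · refine (poissonBivectorLeft_right_right x _ _).trans ?_
      rw [algBracket_self, map_zero, neg_zero]
    · exact poissonBivectorLeft_left_right x _ _
    · exact poissonBivectorLeft_right_left x _ _
    · refine (poissonBivectorLeft_left_left x _ _).trans ?_
      rw [algBracket_self, map_zero]

theorem linearIndependent_casimirFamily (hU : IsOpen U) (hC : ∀ i, IsCasimirOn G (C i) U)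
    (hh : ContDiff ℝ ∞ h) {ξ ζ : E} {x : CotangentBundle E G} (hx : rightMomentum x ∈ U)
    (hli : LinearIndependent ℝ fun i => fderiv ℝ (C i) (rightMomentum x))
    (hnc : rightMomentum x ∈ nonCasimirSet G h) (hξ : leftMomentum x (algBracket G ξ ζ) ≠ 0) :
    LinearIndependent ℝ fun i =>
      cotangentDiff (casimirFamily C (fun x => h (rightMomentum x)) ξ i) x := by
  obtain ⟨η, hη⟩ := hnc
  rw [cotangentDiff_casimirFamily hU hC hh ξ hx]
  refine linearIndependent_sumElim_pair
    (linearIndependent_componentDiff_right (linearIndependent_bidualVector hli) x)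
    (poissonBivectorLeft (componentDiff rightMomentum x η))
    (poissonBivectorLeft (componentDiff leftMomentum x ζ)) (fun i => ?_) ?_ ?_ (fun i => ?_) ?_ ?_
  · rw [poissonBivectorLeft_right_right, (hC i).apply_algBracket hx, neg_zero]
  · rw [poissonBivectorLeft_right_right, neg_ne_zero]
    exact hη
  · exact poissonBivectorLeft_right_left x _ _
  · exact poissonBivectorLeft_left_right x _ _
  · exact poissonBivectorLeft_left_right x _ _
  · rw [poissonBivectorLeft_left_left]
    exact hξ

theorem subset_closure_linearIndependent_casimirFamily (hU : IsOpen U)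
    (hC : ∀ i, IsCasimirOn G (C i) U)
    (hli : U ⊆ closure {ν ∈ U | LinearIndependent ℝ (fun i => fderiv ℝ (C i) ν)})
    (hh : ContDiff ℝ ∞ h) {ξ : E} (hξ : ∃ ζ : E, algBracket G ξ ζ ≠ 0)
    (hnc : Dense (rightMomentum ⁻¹' nonCasimirSet G h : Set (CotangentBundle E G))) :
    {x : CotangentBundle E G | rightMomentum x ∈ U} ⊆
      closure {x | rightMomentum x ∈ U ∧ LinearIndependent ℝ (fun i =>
        cotangentDiff (casimirFamily C (fun x => h (rightMomentum x)) ξ i) x)} := by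
  obtain ⟨ζ, hζ⟩ := hξ
  set S := {ν | ν ∈ U ∧ LinearIndependent ℝ (fun i => fderiv ℝ (C i) ν)} with hS
  have hSo : IsOpen (rightMomentum ⁻¹' S : Set (CotangentBundle E G)) :=
    (isOpen_inter_linearIndependent_fderiv hU fun i => (hC i).smooth).preimage
      contMDiff_rightMomentum.continuous
  have hD : Dense (rightMomentum ⁻¹' nonCasimirSet G h ∩
      leftMomentum ⁻¹' {ν | ν (algBracket G ξ ζ) ≠ 0} : Set (CotangentBundle E G)) :=
    -- The conditions on `J_R` and on `J_L` are each dense; openness of the first makes their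
    -- intersection dense.
    hnc.inter_of_isOpen_left (dense_leftMomentum_preimage (dense_apply_ne_zero hζ))
      ((isOpen_nonCasimirSet hh).preimage contMDiff_rightMomentum.continuous)
  intro x hx
  have h1 : x ∈ closure (rightMomentum ⁻¹' S) := mem_closure_rightMomentum_preimage (hli hx)
  refine closure_minimal ?_ isClosed_closure h1
  refine (hD.open_subset_closure_inter hSo).trans (closure_mono ?_)
  rintro y ⟨⟨hyU, hyli⟩, hync, hyξ⟩
  exact ⟨hyU, linearIndependent_casimirFamily hU hC hh hyU hyli hync hyξ⟩

end CasimirFamily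

end Integrability
end

theorem mainTheorem3
    {E : Type*} [NormedAddCommGroup E] [NormedSpace ℝ E] [FiniteDimensional ℝ E]
    {G : Type*} [TopologicalSpace G] [ChartedSpace E G] [Group G] [LieGroup 𝓘(ℝ, E) ∞ G]
    -- the generic coadjoint orbit is 2-dimensional
    (hgen : Dense {μ : E →L[ℝ] ℝ | coadjointOrbitDim G μ = 2})
    (H : CotangentBundle E G → ℝ) (hH : IsSmoothOnCotangent H) (hinv : IsLeftInvariant H) :
    -- the Hamiltonian flow of `H` is integrable, with `H` among the integrals when possible
    (∃ F : Fin (Module.finrank ℝ E) → CotangentBundle E G → ℝ,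
      IsCompleteSystemOfIntegrals H F ∧ (IsNowhereCasimir H → ∃ i, F i = H)) ∧
    -- there are `n - 2` independent Casimirs around each point of a 2-dimensional orbit
    (∀ μ : E →L[ℝ] ℝ, coadjointOrbitDim G μ = 2 →
      ∃ U : Set (E →L[ℝ] ℝ), IsOpen U ∧ μ ∈ U ∧
        ∃ C : Fin (Module.finrank ℝ E - 2) → (E →L[ℝ] ℝ) → ℝ,
          (∀ i, IsCasimirOn G (C i) U) ∧
          ∀ ν ∈ U, LinearIndependent ℝ (fun i => fderiv ℝ (C i) ν)) ∧
    -- such Casimirs, `H` and a component of `J_L` are in involution and independent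
    (∀ U : Set (E →L[ℝ] ℝ), IsOpen U →
      ∀ C : Fin (Module.finrank ℝ E - 2) → (E →L[ℝ] ℝ) → ℝ,
        (∀ i, IsCasimirOn G (C i) U) →
        U ⊆ closure {ν ∈ U | LinearIndependent ℝ (fun i => fderiv ℝ (C i) ν)} →
      ∀ ξ : E, (∃ η : E, algBracket G ξ η ≠ 0) →
        (∀ i j, ∀ x : CotangentBundle E G, rightMomentum x ∈ U →
          poissonBracket (casimirFamily C H ξ i) (casimirFamily C H ξ j) x = 0) ∧
        (IsNowhereCasimir H →
          {x : CotangentBundle E G | rightMomentum x ∈ U} ⊆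
            closure {x | rightMomentum x ∈ U ∧
              LinearIndependent ℝ (fun i => cotangentDiff (casimirFamily C H ξ i) x)})) := by
  have hp := isDecomposable_algBracketCLM hgen
  have hβ : ∃ a b : E, algBracketCLM G a b ≠ 0 := by
    obtain ⟨μ, hμ⟩ := hgen.nonempty
    obtain ⟨a, b, hab⟩ := exists_apply_algBracket_ne_zero hμ
    exact ⟨a, b, fun h0 => hab (by rw [h0, map_zero])⟩
  have hk := hasCommutingFamily algBracketCLM_skew algBracketCLM_leibniz hp hβ
  obtain ⟨h, hh, rfl⟩ : ∃ h : (E →L[ℝ] ℝ) → ℝ, ContDiff ℝ ∞ h ∧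
      H = fun x => h (rightMomentum x) :=
    ⟨_, contDiff_restrict_fibre hH 1, funext (isLeftInvariant_eq hinv)⟩
  refine ⟨?_, fun μ hμ => exists_local_casimirs hp hμ, fun U hU C hC hli ξ hξ =>
    ⟨fun i j x hx => poissonBracket_casimirFamily hU hC hh ξ hx i j, fun hnc =>
      subset_closure_linearIndependent_casimirFamily hU hC hli hh hξ
        ((isNowhereCasimir_iff hh).1 hnc)⟩⟩
  -- A nowhere Casimir `h` serves as its own function `f`. Otherwise the perturbed function replaces
  -- it, and the clause about `H` being an integral of the family is vacuous.
  by_cases hnc : IsNowhereCasimir (fun x : CotangentBundle E G => h (rightMomentum x))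
  · obtain ⟨F, hF, hi⟩ := exists_completeSystem hk hh hh
      (fun μ => by rw [algBracket_self, map_zero]) ((isNowhereCasimir_iff hh).1 hnc)
    exact ⟨F, hF, fun _ => hi⟩
  · obtain ⟨f, hf, hfh, hd⟩ := exists_commuting_nowhere_casimir hβ hh
    obtain ⟨F, hF, -⟩ := exists_completeSystem hk hh hf hfh (dense_rightMomentum_preimage hd)
    exact ⟨F, hF, fun h => absurd h hnc⟩
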